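/- Setting. Fix $d\ge 0$ and $\alpha\in(0,1)$. For probability measures $\mu,\nu$ let $W_2(\mu,\nu)=\big(\inf_{\gamma\in\Pi(\mu,\nu)}\int \|x-y\|^2\,d\gamma(x,y)\big)^{1/2}$, where $\Pi(\mu,\nu)$ is the set of couplings of $\mu$ and $\nu$. There are $K$ clients. Client $k$ holds samples $x^k_1,\dots,x^k_m\sim P^k$ and $y^k_1,\dots,y^k_n\sim Q^k$ in $\mathbb R^d$; all observations, within and between clients, are independent. Let $P^k_m,Q^k_n$ be the empirical distributions of these samples and $$\widehat{\mathrm{ITD}}^2=\frac1K\sum_{k=1}^K W_2^2(P^k_m,Q^k_n).$$ Permutation test. Client $k$ draws $B_k\ge 1$ independent uniformly random permutations of its pooled sample $(x^k_1,\dots,x^k_m,y^k_1,\dots,y^k_n)$; for each of them it computes $W_2^2$ between the empirical distributions of the first $m$ and of the last $n$ permuted points. In each of $B\ge1$ rounds $b$ the server selects, independently and uniformly, one of the $B_k$ permuted values of every client $k$, and $\widehat{\mathrm{ITD}}_b^{2,\pi}$ is the mean over $k$ of the selected values. The test rejects when $\widehat{\mathrm{ITD}}^2\ge c_{1-\alpha}^{m,n,K}$,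 where $$c_{1-\alpha}^{m,n,K}=\inf\Big\{z\in\mathbb R:\ \frac1B\sum_{b=1}^B \mathbf 1\big(\widehat{\mathrm{ITD}}_b^{2,\pi}<z\big)\ge 1-\alpha\Big\}.$$ The power is the probability of rejection, over the data, the permutations and the selections. The numbers $B$ and $B_k$ may depend on $m,n,K$ in any way. Theorem. (i) ($K$ fixed.) Let $P^1,\dots,P^K,Q^1,\dots,Q^K$ be probability measures on $\mathbb R^d$ with Lebesgue densities and finite fourth moments, and suppose that $P^k\ne Q^k$ for at least one $k$. Then the power tends to $1$ as $m,n\to\infty$ (jointly, at any relative rates). (ii) ($K\to\infty$, given clients.) Let $(P^k)_{k\ge1},(Q^k)_{k\ge1}$ be sequences of probability measures on $\mathbb R^d$ with Lebesgue densities and finite fourth moments. Suppose that the averages $\frac1K\sum_{k=1}^K\int\|x\|^4\,(dP^k+dQ^k)$ are bounded in $K$, and that for some $\delta>0$ one has $\frac1K\sum_{k=1}^K W_2^2(P^k,Q^k)\ge\delta$ for all large $K$. Then the power of the test on the first $K$ clients tends to $1$ as $m,n,K\to\infty$ (jointly, at any relative rates). (iii) ($K\to\infty$, sampled clients.) Let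 $\mathcal X$ be a complete separable metric space, $\lambda$ a Borel probability measure on $\mathcal X$ with $\int d(x,x_0)^2\,d\lambda<\infty$, and let $P,Q$ be measurable kernels from $\mathcal X$ to probability measures on $\mathbb R^d$ with finite second moments satisfying $\int\|y-y_0\|^2\,P(dy|x)\le C(1+d(x,x_0)^2)$ for all $x$, and likewise for $Q$, for some $C,x_0,y_0$. Suppose that for $\lambda$-almost every $x$ the measures $P(\cdot|x)$ and $Q(\cdot|x)$ have Lebesgue densities and finite fourth moments, and that the kernels differ in the integrated transportation distance: $\int W_2^2(P(\cdot|x),Q(\cdot|x))\,\lambda(dx)>0$. Let the clients $x_1,\dots,x_K$ be drawn independently from $\lambda$, with $P^k=P(\cdot|x_k)$, $Q^k=Q(\cdot|x_k)$. Then the power, averaged over the draw of the clients, tends to $1$ as $m,n,K\to\infty$ (jointly, at any relative rates). -/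

import Mathlib

open MeasureTheory ProbabilityTheory Filter Topology
open scoped ENNReal

namespace DistributedTest

noncomputable section

/-- The coupling set of `μ` and `ν`: measures on the product with marginals `μ` and `ν`. -/
def couplings {X : Type*} [MeasurableSpace X] (μ ν : Measure X) : Set (Measure (X × X)) :=
  {γ | γ.map Prod.fst = μ ∧ γ.map Prod.snd = ν}

/-- The optimal transport (Wasserstein) distance of order `p`, with values in `[0, ∞]`. -/
def wasserstein {X : Type*} [MetricSpace X] [MeasurableSpace X] (p : ℝ) (μ ν : Measure X) :
    ℝ≥0∞ :=
  (⨅ γ ∈ couplings μ ν, ∫⁻ z, edist z.1 z.2 ^ p ∂γ) ^ (1 / p)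

/-- Membership in the measure space of order `p`: a probability measure with finite `p`-th moment. -/
def IsOfOrder {X : Type*} [MetricSpace X] [MeasurableSpace X] (p : ℝ) (μ : Measure X) : Prop :=
  IsProbabilityMeasure μ ∧ ∃ x₀ : X, ∫⁻ x, edist x₀ x ^ p ∂μ < ∞

/-- Membership in the kernel space of order `p`: a measurable kernel of measures of order `p`
whose `p`-th moments grow at most like `C * (1 + d(x, x₀) ^ p)`. -/
def IsKernelOfOrder {X Y : Type*} [MetricSpace X] [MeasurableSpace X]
    [MetricSpace Y] [MeasurableSpace Y] (p : ℝ) (P : Kernel X Y) : Prop :=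
  (∀ x, IsOfOrder p (P x)) ∧
    ∃ (x₀ : X) (y₀ : Y) (C : ℝ), 0 < C ∧
      ∀ x, ∫⁻ y, edist y y₀ ^ p ∂(P x) ≤ ENNReal.ofReal C * (1 + edist x x₀ ^ p)

/-- The integrated transportation distance of degree `p` between two kernels, with marginal `lam`. -/
def kernelITD {X Y : Type*} [MeasurableSpace X] [MetricSpace Y] [MeasurableSpace Y]
    (p : ℝ) (lam : Measure X) (P Q : Kernel X Y) : ℝ≥0∞ :=
  (∫⁻ x, wasserstein p (P x) (Q x) ^ p ∂lam) ^ (1 / p)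

/-- `ℝ^d` with the Euclidean distance. -/
abbrev Pt (d : ℕ) : Type := EuclideanSpace ℝ (Fin d)

/-- `μ` has a density with respect to Lebesgue measure. -/
def HasDensity {d : ℕ} (μ : Measure (Pt d)) : Prop :=
  ∃ f : Pt d → ℝ≥0∞, Measurable f ∧ μ = volume.withDensity f

/-- The fourth moment of `μ`. -/
def fourthMoment {d : ℕ} (μ : Measure (Pt d)) : ℝ≥0∞ := ∫⁻ x, ‖x‖ₑ ^ 4 ∂μ

/-- The squared integrated transportation distance of order two over finitely many clients with
weights `w`. -/
def itdSq {d K : ℕ} (w : Fin K → ℝ) (P Q : Fin K → Measure (Pt d)) : ℝ :=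
  ∑ k, w k * (wasserstein 2 (P k) (Q k)).toReal ^ 2

/-- Equal weights `1 / K`. -/
def equalWeights (K : ℕ) : Fin K → ℝ := fun _ => 1 / (K : ℝ)

/-- The empirical distribution of a sample. -/
def empirical {d n : ℕ} (x : Fin n → Pt d) : Measure (Pt d) :=
  (n : ℝ≥0∞)⁻¹ • ∑ i, Measure.dirac (x i)

/-- The first `m` points of the pooled sample `(x, y)` after the permutation `σ`. -/
def permFirst {d m n : ℕ} (σ : Equiv.Perm (Fin (m + n))) (x : Fin m → Pt d) (y : Fin n → Pt d) :
    Fin m → Pt d :=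
  fun i => Fin.append x y (σ (Fin.castAdd n i))

/-- The remaining `n` points of the pooled sample `(x, y)` after the permutation `σ`. -/
def permLast {d m n : ℕ} (σ : Equiv.Perm (Fin (m + n))) (x : Fin m → Pt d) (y : Fin n → Pt d) :
    Fin n → Pt d :=
  fun j => Fin.append x y (σ (Fin.natAdd m j))

/-- The data of all clients: client `k` holds a sample of size `m` and a sample of size `n`. -/
abbrev Data (d m n K : ℕ) : Type := Fin K → (Fin m → Pt d) × (Fin n → Pt d)

/-- The permutations drawn by the clients: client `k` draws `Bk k` of them. -/
abbrev Perms (m n : ℕ) {K : ℕ} (Bk : Fin K → ℕ) : Type :=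
  (k : Fin K) → Fin (Bk k) → Equiv.Perm (Fin (m + n))

/-- The selections of the server: in each of `B` rounds, one permuted statistic for each client. -/
abbrev Selections {K : ℕ} (B : ℕ) (Bk : Fin K → ℕ) : Type := Fin B → (k : Fin K) → Fin (Bk k)

/-- The test statistic: the weighted sum of `W₂²` between the empirical distributions. -/
def statistic {d m n K : ℕ} (w : Fin K → ℝ) (D : Data d m n K) : ℝ :=
  itdSq w (fun k => empirical (D k).1) (fun k => empirical (D k).2)

/-- The integrated permuted statistic computed by the server in round `b`. -/
def permStatistic {d m n K B : ℕ} {Bk : Fin K → ℕ} (w : Fin K → ℝ) (D : Data d m n K)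
    (σ : Perms m n Bk) (s : Selections B Bk) (b : Fin B) : ℝ :=
  itdSq w (fun k => empirical (permFirst (σ k (s b k)) (D k).1 (D k).2))
    (fun k => empirical (permLast (σ k (s b k)) (D k).1 (D k).2))

open Classical in
/-- The critical value: the infimum of the `z` such that at least a fraction `1 - α` of the
permuted statistics `T b` is less than `z`. -/
def criticalValue {B : ℕ} (α : ℝ) (T : Fin B → ℝ) : ℝ :=
  sInf {z : ℝ | 1 - α ≤ (1 / (B : ℝ)) * ∑ b, (if T b < z then (1 : ℝ) else 0)}

/-- All subsets of the finite set of permutations are measurable. -/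
instance permMeasurableSpace (N : ℕ) : MeasurableSpace (Equiv.Perm (Fin N)) := ⊤

/-- The joint law of data, permutations and selections: all samples are independent, those of
client `k` having laws `P k` and `Q k`; the permutations and the selections are uniform,
independent of one another and of the data. -/
def experimentLaw {d K : ℕ} (m n B : ℕ) (Bk : Fin K → ℕ) (P Q : Fin K → Measure (Pt d)) :
    Measure (Data d m n K × Perms m n Bk × Selections B Bk) :=
  (Measure.pi fun k => (Measure.pi fun _ : Fin m => P k).prod (Measure.pi fun _ : Fin n => Q k)).prod
    ((Measure.pi fun _ => Measure.pi fun _ => uniformOn Set.univ).prod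
      (Measure.pi fun _ => Measure.pi fun _ => uniformOn Set.univ))

/-- The probability that the permutation test rejects. -/
def power {d K : ℕ} (α : ℝ) (w : Fin K → ℝ) (m n B : ℕ) (Bk : Fin K → ℕ)
    (P Q : Fin K → Measure (Pt d)) : ℝ≥0∞ :=
  experimentLaw m n B Bk P Q
    {ω | criticalValue α (permStatistic w ω.1 ω.2.1 ω.2.2) ≤ statistic w ω.1}

end

end DistributedTest

namespace DistributedTest

open scoped NNReal

/-! The test compares the statistic with the level `δ / 8`, where `δ > 0` bounds the true squared
distance from below. It rejects as soon as the statistic is at least `δ / 8` and at most a fraction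
`α` of the permuted statistics reach that level, since the critical value is then at most `δ / 8`.
`one_le_power_add` bounds the probabilities of the two failures.

The statistic can only be small if the empirical distributions are far from their laws: the squared
triangle inequality gives W₂²(P,Q) ≤ 4 (W₂²(Pₘ,P) + W₂²(Qₙ,Q)) + 4 W₂²(Pₘ,Qₙ), and Markov's
inequality applies to the average over the clients. For the permuted statistics Markov's inequality
is applied once, to their mean over the rounds. Both bounds are linear in the clients and the
rounds, so only the law of one client's data with one selected permutation matters. The dependence
between rounds plays no role, and the result is uniform in `B`, `Bk` and `K`.

It remains to bound expected transport costs. `IsCellPartition.transportCost_le` cuts a ball of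
radius `R` into finitely many cells of diameter at most `ε`: common mass is matched within the cells
at cost `ε ^ 2`, excess mass in the ball costs a multiple of `R ^ 2` times the cell discrepancies,
and the rest is paid for by tail second moments. This bound, unlike an infimum over couplings, is
visibly measurable in the sample. Cell frequencies of independent samples have variance at most `1 /
n`. Given the data, each part of a permuted pooled sample is drawn without replacement, and negative
correlation (`sum_perm_mul_nonpos`) gives the same rate around the pooled frequency, whatever the
ratio of `m` to `n`. Choosing `R`, then `ε` and the cells, then `m` and `n` makes everything small.

The radius `R` must serve the clients on average: it comes from the bound on the average fourth
moments for given clients, and from the second moments of the mixtures `lam.bind P` and `lam.bind Q`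
for sampled clients. In the sampled case a law of large numbers supplies `δ`: a positive fraction of
the clients falls in a set where the cost is bounded below. -/

/-- The optimal quadratic transport cost between `μ` and `ν`. -/
noncomputable def transportCost {X : Type*} [MetricSpace X] [MeasurableSpace X]
    (μ ν : Measure X) : ℝ≥0∞ :=
  ⨅ γ ∈ couplings μ ν, ∫⁻ z, edist z.1 z.2 ^ 2 ∂γ

lemma add_sq_le_two_mul (a b : ℝ≥0∞) : (a + b) ^ 2 ≤ 2 * a ^ 2 + 2 * b ^ 2 := by
  have := ENNReal.rpow_add_le_mul_rpow_add_rpow a b (p := 2) (by norm_num)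
  norm_num at this
  rwa [mul_add] at this

lemma edist_sq_le {X : Type*} [MetricSpace X] (x y z : X) : edist x z ^ 2 ≤ 2 * edist x y ^ 2 + 2 * edist y z ^ 2 :=
  (pow_le_pow_left' (edist_triangle x y z) 2).trans (add_sq_le_two_mul _ _)

lemma isProbabilityMeasure_of_mem_couplings {X : Type*} [MeasurableSpace X] {μ ν : Measure X}
    [IsProbabilityMeasure μ] {γ : Measure (X × X)} (h : γ ∈ couplings μ ν) : IsProbabilityMeasure γ := by
  refine ⟨?_⟩
  have := congrArg (fun m => m Set.univ) h.1
  simpa [Measure.map_apply measurable_fst MeasurableSet.univ] using this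

/-! ### Quadratic transport cost: gluing and separation of measures -/

section TransportCost

variable {X : Type*} [MetricSpace X] [MeasurableSpace X]

lemma wasserstein_two_rpow_two (μ ν : Measure X) :
    wasserstein 2 μ ν ^ (2 : ℝ) = transportCost μ ν := by
  unfold wasserstein transportCost
  rw [← ENNReal.rpow_mul]
  norm_num

lemma toReal_wasserstein_two_sq (μ ν : Measure X) :
    (wasserstein 2 μ ν).toReal ^ 2 = (transportCost μ ν).toReal := by
  rw [← wasserstein_two_rpow_two, ← ENNReal.toReal_rpow]
  norm_num

lemma transportCost_le {μ ν : Measure X} {γ : Measure (X × X)} (h : γ ∈ couplings μ ν) :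
    transportCost μ ν ≤ ∫⁻ z, edist z.1 z.2 ^ 2 ∂γ :=
  iInf₂_le γ h

lemma exists_coupling_lintegral_lt {μ ν : Measure X} {c : ℝ≥0∞} (h : transportCost μ ν < c) :
    ∃ γ ∈ couplings μ ν, ∫⁻ z, edist z.1 z.2 ^ 2 ∂γ < c := by
  simpa only [transportCost, iInf_lt_iff, exists_prop] using h

lemma transportCost_comm [BorelSpace X] [SecondCountableTopology X] (μ ν : Measure X) :
    transportCost μ ν = transportCost ν μ := by
  have key : ∀ μ ν : Measure X, transportCost μ ν ≤ transportCost ν μ := by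
    intro μ ν
    refine le_iInf₂ fun γ hγ => ?_
    refine (transportCost_le (γ := γ.map Prod.swap) ⟨?_, ?_⟩).trans_eq ?_
    · rw [Measure.map_map measurable_fst measurable_swap]; exact hγ.2
    · rw [Measure.map_map measurable_snd measurable_swap]; exact hγ.1
    · rw [lintegral_map (by fun_prop) measurable_swap]
      simp [edist_comm]
  exact le_antisymm (key μ ν) (key ν μ)

/-- Gluing: the quadratic transport cost satisfies the triangle inequality up to a factor. -/
lemma transportCost_triangle [BorelSpace X] [SecondCountableTopology X] [StandardBorelSpace X]
    [Nonempty X] (μ ν ρ : Measure X) [IsProbabilityMeasure μ] [IsProbabilityMeasure ν]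
    [IsProbabilityMeasure ρ] :
    transportCost μ ρ ≤ 2 * transportCost μ ν + 2 * transportCost ν ρ := by
  have key : ∀ γ₁ ∈ couplings ν μ, ∀ γ₂ ∈ couplings ν ρ, transportCost μ ρ ≤
      2 * (∫⁻ z, edist z.1 z.2 ^ 2 ∂γ₁) + 2 * ∫⁻ z, edist z.1 z.2 ^ 2 ∂γ₂ := by
    intro γ₁ h₁ γ₂ h₂
    have := isProbabilityMeasure_of_mem_couplings h₁
    have := isProbabilityMeasure_of_mem_couplings h₂
    have e₁ : ν ⊗ₘ γ₁.condKernel = γ₁ := by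
      conv_rhs => rw [← γ₁.disintegrate γ₁.condKernel]
      rw [Measure.fst, h₁.1]
    have e₂ : ν ⊗ₘ γ₂.condKernel = γ₂ := by
      conv_rhs => rw [← γ₂.disintegrate γ₂.condKernel]
      rw [Measure.fst, h₂.1]
    -- The middle point has law `ν`; given it, the two outer points are drawn independently from the
    -- two conditional laws.
    set π := ν ⊗ₘ (γ₁.condKernel ×ₖ γ₂.condKernel) with hπ
    have m₁ : Measurable fun p : X × X × X => (p.1, p.2.1) := by fun_prop
    have m₂ : Measurable fun p : X × X × X => (p.1, p.2.2) := by fun_prop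
    have p₁ : π.map (fun p => (p.1, p.2.1)) = γ₁ := by
      rw [← e₁]
      refine Measure.ext_of_lintegral _ fun f hf => ?_
      rw [lintegral_map hf m₁, Measure.lintegral_compProd (by fun_prop),
        Measure.lintegral_compProd hf]
      refine lintegral_congr fun y => ?_
      rw [Kernel.prod_apply, lintegral_prod _ (by fun_prop)]
      simp
    have p₂ : π.map (fun p => (p.1, p.2.2)) = γ₂ := by
      rw [← e₂]
      refine Measure.ext_of_lintegral _ fun f hf => ?_
      rw [lintegral_map hf m₂, Measure.lintegral_compProd (by fun_prop),
        Measure.lintegral_compProd hf]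
      refine lintegral_congr fun y => ?_
      rw [Kernel.prod_apply, lintegral_prod _ (by fun_prop)]
      simp
    have hc : π.map Prod.snd ∈ couplings μ ρ := by
      constructor
      · rw [Measure.map_map measurable_fst measurable_snd, ← h₁.2, ← p₁,
          Measure.map_map measurable_snd m₁]
        rfl
      · rw [Measure.map_map measurable_snd measurable_snd, ← h₂.2, ← p₂,
          Measure.map_map measurable_snd m₂]
        rfl
    refine (transportCost_le hc).trans ?_
    rw [lintegral_map (by fun_prop) measurable_snd, ← p₁, ← p₂,
      lintegral_map (by fun_prop) m₁, lintegral_map (by fun_prop) m₂,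
      ← lintegral_const_mul _ (by fun_prop), ← lintegral_const_mul _ (by fun_prop),
      ← lintegral_add_left (by fun_prop)]
    refine lintegral_mono fun p => ?_
    have := edist_sq_le p.2.1 p.1 p.2.2
    rwa [edist_comm p.2.1 p.1] at this
  rw [transportCost_comm μ ν]
  refine ENNReal.le_of_forall_pos_le_add fun ε hε hfin => ?_
  -- Each near-optimal coupling enters with a factor 2, so two errors of `ε / 4` add up to `ε`.
  have hε' : (ε : ℝ≥0∞) / 4 ≠ 0 := by simp [hε.ne']
  have t₁ : transportCost ν μ ≠ ∞ := by
    intro h; simp [h] at hfin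
  have t₂ : transportCost ν ρ ≠ ∞ := by
    intro h; simp [h] at hfin
  obtain ⟨γ₁, h₁, c₁⟩ := exists_coupling_lintegral_lt (ENNReal.lt_add_right t₁ hε')
  obtain ⟨γ₂, h₂, c₂⟩ := exists_coupling_lintegral_lt (ENNReal.lt_add_right t₂ hε')
  refine (key γ₁ h₁ γ₂ h₂).trans ?_
  calc _ ≤ 2 * (transportCost ν μ + (ε : ℝ≥0∞) / 4) + 2 * (transportCost ν ρ + (ε : ℝ≥0∞) / 4) := by
        gcongr
    _ = 2 * transportCost ν μ + 2 * transportCost ν ρ + 4 * ((ε : ℝ≥0∞) / 4) := by ring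
    _ = _ := by rw [ENNReal.mul_div_cancel (by norm_num) (by norm_num)]

/-- A vanishing transport cost forces equality of the measures. -/
lemma eq_of_transportCost_eq_zero [BorelSpace X] [SecondCountableTopology X]
    (μ ν : Measure X) [IsProbabilityMeasure μ] [IsProbabilityMeasure ν]
    (h : transportCost μ ν = 0) : μ = ν := by
  have key : ∀ μ ν : Measure X, IsProbabilityMeasure μ → IsProbabilityMeasure ν →
      transportCost μ ν = 0 → ∀ F : Set X, IsClosed F → μ F ≤ ν F := by
    intro μ ν _ _ h F hF
    have hthick : ∀ δ : ℝ, 0 < δ → μ F ≤ ν (Metric.cthickening δ F) := by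
      intro δ hδ
      have hδ2 : ENNReal.ofReal δ ^ 2 ≠ 0 := by simp [hδ]
      have hδ3 : ENNReal.ofReal δ ^ 2 ≠ ∞ := by simp
      refine ENNReal.le_of_forall_pos_le_add fun ε hε _ => ?_
      -- With cost below `δ ^ 2 * ε`, Markov's inequality leaves at most `ε` of the mass moving by
      -- `δ` or more.
      obtain ⟨γ, hγ, hc⟩ := exists_coupling_lintegral_lt (μ := μ) (ν := ν)
        (c := ENNReal.ofReal δ ^ 2 * ε) (by rw [h]; exact ENNReal.mul_pos hδ2 (by simp [hε.ne']))
      have hsub : Prod.fst ⁻¹' F ⊆ (Prod.snd ⁻¹' (Metric.cthickening δ F)) ∪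
          {z : X × X | ENNReal.ofReal δ ^ 2 ≤ edist z.1 z.2 ^ 2} := by
        intro z hz
        by_cases hd : ENNReal.ofReal δ ≤ edist z.1 z.2
        · exact Or.inr (pow_le_pow_left' hd 2)
        · refine Or.inl ?_
          refine Metric.mem_cthickening_of_edist_le z.2 z.1 δ F hz ?_
          rw [edist_comm]; exact (not_le.1 hd).le
      calc μ F = γ (Prod.fst ⁻¹' F) := by
            rw [← hγ.1, Measure.map_apply measurable_fst hF.measurableSet]
        _ ≤ γ (Prod.snd ⁻¹' (Metric.cthickening δ F)) +
            γ {z : X × X | ENNReal.ofReal δ ^ 2 ≤ edist z.1 z.2 ^ 2} :=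
          (measure_mono hsub).trans (measure_union_le _ _)
        _ ≤ ν (Metric.cthickening δ F) + ε := by
          gcongr
          · rw [← hγ.2, Measure.map_apply measurable_snd Metric.isClosed_cthickening.measurableSet]
          · refine (meas_ge_le_lintegral_div (by fun_prop) hδ2 hδ3).trans ?_
            rw [ENNReal.div_le_iff hδ2 hδ3, mul_comm]
            exact hc.le
    -- The thickenings of a closed set shrink to the set as `δ` tends to 0.
    have hlim := tendsto_measure_cthickening_of_isClosed (μ := ν)
      ⟨1, one_pos, measure_ne_top _ _⟩ hF
    refine ge_of_tendsto (hlim.mono_left (nhdsWithin_le_nhds (s := Set.Ioi 0))) ?_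
    filter_upwards [self_mem_nhdsWithin] with δ hδ using hthick δ hδ
  refine ext_of_generate_finite _ (BorelSpace.measurable_eq (α := X) |>.trans
    borel_eq_generateFrom_isClosed) isPiSystem_isClosed (fun F hF => ?_) (by simp)
  exact le_antisymm (key μ ν inferInstance inferInstance h F hF)
    (key ν μ inferInstance inferInstance (by rw [transportCost_comm]; exact h) F hF)

end TransportCost

/-! ### Cell partitions and the resulting bound on the transport cost -/

/-- The part of the second moment of `μ` carried by the points of norm larger than `R`. -/
noncomputable def tailMoment {d : ℕ} (R : ℝ≥0) (μ : Measure (Pt d)) : ℝ≥0∞ :=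
  ∫⁻ x in (Metric.closedBall 0 (R : ℝ))ᶜ, ‖x‖ₑ ^ 2 ∂μ

/-- The total discrepancy of `μ` and `ν` on the cells `C i`, `i ∈ t`. -/
noncomputable def cellDiscrepancy {X : Type*} [MeasurableSpace X] (t : Finset ℕ) (C : ℕ → Set X)
    (μ ν : Measure X) : ℝ≥0∞ :=
  ∑ i ∈ t, ((μ (C i) - ν (C i)) + (ν (C i) - μ (C i)))

/-- A partition of the closed ball of radius `R` into finitely many cells of diameter at most
`ε`. -/
structure IsCellPartition {d : ℕ} (R ε : ℝ≥0) (t : Finset ℕ) (C : ℕ → Set (Pt d)) : Prop where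
  measurableSet : ∀ i, MeasurableSet (C i)
  pairwise_disjoint : Pairwise (Function.onFun Disjoint C)
  iUnion_eq : ⋃ i ∈ t, C i = Metric.closedBall 0 (R : ℝ)
  edist_le : ∀ i, ∀ x ∈ C i, ∀ y ∈ C i, edist x y ≤ ε

/-- By compactness finitely many balls of radius `ε / 2` around points of a dense sequence cover the
ball; they are cut down to it and made disjoint. -/
lemma exists_isCellPartition {d : ℕ} (R : ℝ≥0) {ε : ℝ≥0} (hε : 0 < ε) :
    ∃ (t : Finset ℕ) (C : ℕ → Set (Pt d)), IsCellPartition R ε t C := by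
  classical
  have hc : IsCompact (Metric.closedBall (0 : Pt d) (R : ℝ)) := isCompact_closedBall _ _
  have hε2 : (0 : ℝ) < ε / 2 := by positivity
  obtain ⟨t, ht⟩ := hc.elim_finite_subcover
    (fun i : ℕ => Metric.ball (TopologicalSpace.denseSeq (Pt d) i) (ε / 2))
    (fun i => Metric.isOpen_ball) (by
      intro x _
      obtain ⟨_, hi, ⟨i, rfl⟩⟩ :=
        Metric.dense_iff.1 (TopologicalSpace.denseRange_denseSeq (Pt d)) x _ hε2
      exact Set.mem_iUnion.2 ⟨i, by rw [Metric.mem_ball, dist_comm]; exact hi⟩)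
  -- The sets outside `t` are empty, so the disjointed family indexed by all of `ℕ` has its union
  -- carried by `t`.
  set A : ℕ → Set (Pt d) := fun i => if i ∈ t then
    Metric.closedBall 0 (R : ℝ) ∩ Metric.ball (TopologicalSpace.denseSeq (Pt d) i) (ε / 2) else ∅
    with hA
  have hsub : ∀ i, disjointed A i ⊆ A i := fun i => disjointed_subset A i
  refine ⟨t, disjointed A, fun i => ?_, disjoint_disjointed A, ?_, ?_⟩
  · refine MeasurableSet.disjointed (fun i => ?_) i
    simp only [hA]
    split_ifs
    · exact measurableSet_closedBall.inter measurableSet_ball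
    · exact MeasurableSet.empty
  · refine Set.Subset.antisymm (Set.iUnion₂_subset fun i hi => (hsub i).trans ?_) fun x hx => ?_
    · simp [hA, hi]
    · obtain ⟨i, hi, hxi⟩ := Set.mem_iUnion₂.1 (ht hx)
      have : x ∈ ⋃ i, disjointed A i := by
        rw [iUnion_disjointed]
        exact Set.mem_iUnion.2 ⟨i, by simp only [hA, if_pos hi]; exact ⟨hx, hxi⟩⟩
      obtain ⟨j, hj⟩ := Set.mem_iUnion.1 this
      refine Set.mem_iUnion₂.2 ⟨j, ?_, hj⟩
      by_contra hjt
      have := hsub j hj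
      simp [hA, hjt] at this
  · intro i x hx y hy
    have hx := hsub i hx
    have hy := hsub i hy
    by_cases hi : i ∈ t
    · simp only [hA, if_pos hi] at hx hy
      have h1 := Metric.mem_ball.1 hx.2
      have h2 := Metric.mem_ball.1 hy.2
      have h3 := dist_triangle_right x y (TopologicalSpace.denseSeq (Pt d) i)
      rw [edist_dist, ← ENNReal.ofReal_coe_nnreal]
      exact ENNReal.ofReal_le_ofReal (by linarith)
    · simp [hA, hi] at hx

lemma edist_sq_le_norm {d : ℕ} (x y : Pt d) : edist x y ^ 2 ≤ 2 * ‖x‖ₑ ^ 2 + 2 * ‖y‖ₑ ^ 2 := by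
  simpa [edist_comm (0 : Pt d) y] using edist_sq_le x 0 y

/-- A partial coupling is completed by the product of the residual measures. -/
lemma transportCost_le_of_partial_coupling {d : ℕ} {μ ν μ' ν' : Measure (Pt d)}
    {γ : Measure (Pt d × Pt d)} [IsProbabilityMeasure μ] [IsProbabilityMeasure ν]
    (h₁ : γ.map Prod.fst + μ' = μ) (h₂ : γ.map Prod.snd + ν' = ν) :
    transportCost μ ν ≤ ∫⁻ z, edist z.1 z.2 ^ 2 ∂γ +
      (2 * ∫⁻ x, ‖x‖ₑ ^ 2 ∂μ' + 2 * ∫⁻ x, ‖x‖ₑ ^ 2 ∂ν') := by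
  have e₁ : γ Set.univ + μ' Set.univ = 1 := by
    have := congrArg (fun m => m Set.univ) h₁
    simpa [Measure.map_apply measurable_fst MeasurableSet.univ] using this
  have e₂ : γ Set.univ + ν' Set.univ = 1 := by
    have := congrArg (fun m => m Set.univ) h₂
    simpa [Measure.map_apply measurable_snd MeasurableSet.univ] using this
  have hγ : γ Set.univ ≠ ∞ := fun h => by simp [h] at e₁
  have hμ : μ' Set.univ ≠ ∞ := fun h => by simp [h] at e₁
  have hr : ν' Set.univ = μ' Set.univ := (ENNReal.add_right_inj hγ).1 (e₂.trans e₁.symm)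
  have : IsFiniteMeasure μ' := ⟨hμ.lt_top⟩
  have : IsFiniteMeasure ν' := ⟨by rw [hr]; exact hμ.lt_top⟩
  set r := μ' Set.univ with hrdef
  -- Both residuals have mass `r`, so their product has marginals `r` times too large. If `r = 0`
  -- the residuals vanish and the factor `r⁻¹ = ∞` does no harm.
  have hcancel : ∀ m : Measure (Pt d), m Set.univ = r → r⁻¹ • (r • m) = m := by
    intro m hm
    rcases eq_or_ne r 0 with h0 | h0
    · rw [h0, Measure.measure_univ_eq_zero] at hm
      simp [hm]
    · rw [smul_smul, ENNReal.inv_mul_cancel h0 hμ, one_smul]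
  have hc : γ + r⁻¹ • μ'.prod ν' ∈ couplings μ ν := by
    constructor
    · rw [Measure.map_add _ _ measurable_fst, Measure.map_smul, Measure.map_fst_prod, hr,
        hcancel _ rfl, h₁]
    · rw [Measure.map_add _ _ measurable_snd, Measure.map_smul, Measure.map_snd_prod, ← hrdef,
        hcancel _ hr, h₂]
  refine (transportCost_le hc).trans ?_
  rw [lintegral_add_measure, lintegral_smul_measure]
  gcongr
  calc r⁻¹ • ∫⁻ z, edist z.1 z.2 ^ 2 ∂μ'.prod ν'
      ≤ r⁻¹ • ∫⁻ z, (2 * ‖z.1‖ₑ ^ 2 + 2 * ‖z.2‖ₑ ^ 2) ∂μ'.prod ν' := by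
        gcongr with z; exact edist_sq_le_norm z.1 z.2
    _ = r⁻¹ * r * (2 * ∫⁻ x, ‖x‖ₑ ^ 2 ∂μ' + 2 * ∫⁻ x, ‖x‖ₑ ^ 2 ∂ν') := by
        rw [lintegral_prod _ (by fun_prop)]
        have : ∀ x : Pt d, ∫⁻ y, (2 * ‖x‖ₑ ^ 2 + 2 * ‖y‖ₑ ^ 2) ∂ν' =
            2 * ‖x‖ₑ ^ 2 * r + 2 * ∫⁻ y, ‖y‖ₑ ^ 2 ∂ν' := fun x => by
          rw [lintegral_add_left (by fun_prop), lintegral_const, hr,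
            lintegral_const_mul _ (by fun_prop)]
        simp only [this]
        rw [lintegral_add_left (by fun_prop), lintegral_mul_const _ (by fun_prop),
          lintegral_const_mul _ (by fun_prop), lintegral_const, smul_eq_mul]
        ring
    _ ≤ 1 * (2 * ∫⁻ x, ‖x‖ₑ ^ 2 ∂μ' + 2 * ∫⁻ x, ‖x‖ₑ ^ 2 ∂ν') := by
        gcongr; exact ENNReal.inv_mul_le_one _
    _ = _ := one_mul _

namespace IsCellPartition

variable {d : ℕ} {R ε : ℝ≥0} {t : Finset ℕ} {C : ℕ → Set (Pt d)}

lemma sum_restrict (h : IsCellPartition R ε t C) (μ : Measure (Pt d)) :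
    μ.restrict (Metric.closedBall 0 (R : ℝ))ᶜ + ∑ i ∈ t, μ.restrict (C i) = μ := by
  rw [← Measure.sum_coe_finset, ← Measure.restrict_biUnion_finset
    (fun i _ j _ hij => h.pairwise_disjoint hij) h.measurableSet, h.iUnion_eq, add_comm,
    Measure.restrict_add_restrict_compl measurableSet_closedBall]

lemma sum_measure_le (h : IsCellPartition R ε t C) (μ : Measure (Pt d)) [IsProbabilityMeasure μ] :
    ∑ i ∈ t, μ (C i) ≤ 1 := by
  rw [← measure_biUnion_finset (fun i _ j _ hij => h.pairwise_disjoint hij)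
    (fun i _ => h.measurableSet i)]
  exact prob_le_one

/-- The residual of a measure of which the fraction `w i` has been removed from the cell `C i`. -/
noncomputable def residual (R : ℝ≥0) (t : Finset ℕ) (C : ℕ → Set (Pt d)) (w : ℕ → ℝ≥0∞)
    (μ : Measure (Pt d)) : Measure (Pt d) :=
  μ.restrict (Metric.closedBall 0 (R : ℝ))ᶜ + ∑ i ∈ t, (1 - w i) • μ.restrict (C i)

lemma add_residual (h : IsCellPartition R ε t C) (μ : Measure (Pt d)) {w : ℕ → ℝ≥0∞}
    (hw : ∀ i, w i ≤ 1) :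
    ∑ i ∈ t, w i • μ.restrict (C i) + residual R t C w μ = μ := by
  conv_rhs => rw [← h.sum_restrict μ]
  rw [residual, add_left_comm, ← Finset.sum_add_distrib]
  congr 1
  refine Finset.sum_congr rfl fun i _ => ?_
  rw [← add_smul, add_tsub_cancel_of_le (hw i), one_smul]

lemma enorm_le (h : IsCellPartition R ε t C) {i : ℕ} (hi : i ∈ t) {x : Pt d} (hx : x ∈ C i) :
    ‖x‖ₑ ≤ R := by
  have : x ∈ Metric.closedBall (0 : Pt d) (R : ℝ) := by
    rw [← h.iUnion_eq]; exact Set.mem_iUnion₂.2 ⟨i, hi, hx⟩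
  rw [mem_closedBall_zero_iff] at this
  exact_mod_cast this

/-- Removing the fraction `min a b / a` of a cell of mass `a` leaves mass `a - min a b`, the
truncated difference `a - b`, and all of it has norm at most `R`. An empty cell has nothing to
leave. -/
lemma lintegral_residual_le (h : IsCellPartition R ε t C) (μ : Measure (Pt d))
    [IsProbabilityMeasure μ] (b : ℕ → ℝ≥0∞) :
    ∫⁻ x, ‖x‖ₑ ^ 2 ∂(residual R t C (fun i => min (μ (C i)) (b i) / μ (C i)) μ) ≤
      tailMoment R μ + (R : ℝ≥0∞) ^ 2 * ∑ i ∈ t, (μ (C i) - b i) := by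
  rw [residual, lintegral_add_measure, lintegral_finsetSum_measure, tailMoment, Finset.mul_sum]
  gcongr with i hi
  rw [lintegral_smul_measure]
  calc _ ≤ (1 - min (μ (C i)) (b i) / μ (C i)) • ∫⁻ x in C i, (R : ℝ≥0∞) ^ 2 ∂μ := by
        refine smul_le_smul_of_nonneg_left (setLIntegral_mono measurable_const fun x hx => ?_)
          zero_le
        exact pow_le_pow_left' (h.enorm_le hi hx) 2
    _ = (R : ℝ≥0∞) ^ 2 * (μ (C i) - min (μ (C i)) (b i) / μ (C i) * μ (C i)) := by
        rw [setLIntegral_const, smul_eq_mul, mul_left_comm,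
          ENNReal.sub_mul (fun _ _ => measure_ne_top _ _), one_mul]
    _ ≤ _ := by
        refine mul_le_mul' le_rfl ?_
        rcases eq_or_ne (μ (C i)) 0 with h0 | h0
        · simp [h0]
        · rw [ENNReal.div_mul_cancel h0 (measure_ne_top _ _), tsub_min]

/-- The transport cost is controlled by the masses of small cells and the tails. -/
theorem transportCost_le (h : IsCellPartition R ε t C) (μ ν : Measure (Pt d))
    [IsProbabilityMeasure μ] [IsProbabilityMeasure ν] :
    transportCost μ ν ≤ (ε : ℝ≥0∞) ^ 2 + 2 * (R : ℝ≥0∞) ^ 2 * cellDiscrepancy t C μ ν +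
      2 * (tailMoment R μ + tailMoment R ν) := by
  set c : ℕ → ℝ≥0∞ := fun i => min (μ (C i)) (ν (C i)) with hc
  -- In each cell the common mass `c i` is spread over the product of the normalized restrictions.
  -- If either mass is zero then `c i = 0`, which cancels the infinite inverse.
  set γ : Measure (Pt d × Pt d) := ∑ i ∈ t, (c i * ((μ (C i))⁻¹ * (ν (C i))⁻¹)) •
    (μ.restrict (C i)).prod (ν.restrict (C i)) with hγ
  have hfst : γ.map Prod.fst = ∑ i ∈ t, (c i / μ (C i)) • μ.restrict (C i) := by
    rw [hγ, Measure.map_finset_sum measurable_fst.aemeasurable]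
    refine Finset.sum_congr rfl fun i _ => ?_
    rw [Measure.map_smul, Measure.map_fst_prod, smul_smul, Measure.restrict_apply_univ]
    congr 1
    rcases eq_or_ne (ν (C i)) 0 with h0 | h0
    · simp [hc, h0]
    · rw [mul_assoc, mul_assoc, ENNReal.inv_mul_cancel h0 (measure_ne_top _ _), mul_one,
        div_eq_mul_inv]
  have hsnd : γ.map Prod.snd = ∑ i ∈ t, (c i / ν (C i)) • ν.restrict (C i) := by
    rw [hγ, Measure.map_finset_sum measurable_snd.aemeasurable]
    refine Finset.sum_congr rfl fun i _ => ?_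
    rw [Measure.map_smul, Measure.map_snd_prod, smul_smul, Measure.restrict_apply_univ]
    congr 1
    rcases eq_or_ne (μ (C i)) 0 with h0 | h0
    · simp [hc, h0]
    · rw [mul_assoc, mul_comm (μ (C i))⁻¹, mul_assoc,
        ENNReal.inv_mul_cancel h0 (measure_ne_top _ _), mul_one, div_eq_mul_inv]
  have h₁ := h.add_residual μ (w := fun i => c i / μ (C i))
    (fun i => ENNReal.div_le_of_le_mul (by rw [one_mul]; exact min_le_left _ _))
  have h₂ := h.add_residual ν (w := fun i => c i / ν (C i))
    (fun i => ENNReal.div_le_of_le_mul (by rw [one_mul]; exact min_le_right _ _))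
  rw [← hfst] at h₁
  rw [← hsnd] at h₂
  refine (transportCost_le_of_partial_coupling h₁ h₂).trans ?_
  have r₁ := h.lintegral_residual_le μ (fun i => ν (C i))
  have r₂ := h.lintegral_residual_le ν (fun i => μ (C i))
  simp only [min_comm (ν _) (μ _)] at r₂
  have hcost : ∫⁻ z, edist z.1 z.2 ^ 2 ∂γ ≤ (ε : ℝ≥0∞) ^ 2 := by
    rw [hγ, lintegral_finsetSum_measure]
    calc _ ≤ ∑ i ∈ t, (ε : ℝ≥0∞) ^ 2 * μ (C i) := by
          refine Finset.sum_le_sum fun i _ => ?_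
          rw [lintegral_smul_measure, Measure.prod_restrict]
          calc _ ≤ (c i * ((μ (C i))⁻¹ * (ν (C i))⁻¹)) •
                ∫⁻ z in C i ×ˢ C i, (ε : ℝ≥0∞) ^ 2 ∂μ.prod ν := by
                refine smul_le_smul_of_nonneg_left
                  (setLIntegral_mono measurable_const fun z hz => ?_) zero_le
                exact pow_le_pow_left' (h.edist_le i _ hz.1 _ hz.2) 2
            _ = (ε : ℝ≥0∞) ^ 2 * c i * (((μ (C i))⁻¹ * μ (C i)) * ((ν (C i))⁻¹ * ν (C i))) := by
                rw [setLIntegral_const, Measure.prod_prod, smul_eq_mul]; ring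
            _ ≤ (ε : ℝ≥0∞) ^ 2 * μ (C i) * (1 * 1) := by
                gcongr
                · exact min_le_left _ _
                · exact ENNReal.inv_mul_le_one _
                · exact ENNReal.inv_mul_le_one _
            _ = _ := by ring
      _ ≤ (ε : ℝ≥0∞) ^ 2 * 1 := by
          rw [← Finset.mul_sum]; gcongr; exact h.sum_measure_le μ
      _ = _ := mul_one _
  calc _ ≤ (ε : ℝ≥0∞) ^ 2 +
        (2 * (tailMoment R μ + (R : ℝ≥0∞) ^ 2 * ∑ i ∈ t, (μ (C i) - ν (C i))) +
          2 * (tailMoment R ν + (R : ℝ≥0∞) ^ 2 * ∑ i ∈ t, (ν (C i) - μ (C i)))) := by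
        gcongr
    _ = _ := by
        rw [cellDiscrepancy, Finset.sum_add_distrib]; ring

end IsCellPartition

/-! ### Deviations of averages, for sampling with and without replacement -/

/-- The rate `n ^ (-1/2)`, with values in `[0, ∞]`. -/
noncomputable def rate (n : ℕ) : ℝ≥0∞ := ENNReal.ofReal (1 / √n)

section Deviations

/-- Integrate the pointwise inequality `|g| ≤ (√n / 2) g² + 1 / (2 √n)`, whose weights balance the
two terms when `g²` has mean `1 / n`. -/
lemma lintegral_abs_le_rate {Ω : Type*} [MeasurableSpace Ω] (ρ : Measure Ω)
    [IsProbabilityMeasure ρ] {g : Ω → ℝ} (hg : Measurable g) {n : ℕ} (hn : 1 ≤ n)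
    (h : ∫⁻ ω, ENNReal.ofReal (g ω ^ 2) ∂ρ ≤ ENNReal.ofReal (1 / n)) :
    ∫⁻ ω, ENNReal.ofReal |g ω| ∂ρ ≤ rate n := by
  have hs : 0 < √(n : ℝ) := Real.sqrt_pos.2 (by exact_mod_cast hn)
  have hsq : √(n : ℝ) ^ 2 = n := Real.sq_sqrt (by positivity)
  calc ∫⁻ ω, ENNReal.ofReal |g ω| ∂ρ
      ≤ ∫⁻ ω, (ENNReal.ofReal (√n / 2) * ENNReal.ofReal (g ω ^ 2) +
          ENNReal.ofReal (1 / (2 * √n))) ∂ρ := by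
        refine lintegral_mono fun ω => ?_
        rw [← ENNReal.ofReal_mul (by positivity), ← ENNReal.ofReal_add (by positivity)
          (by positivity)]
        refine ENNReal.ofReal_le_ofReal ?_
        have h1 := sq_nonneg (√(n : ℝ) * |g ω| - 1)
        have h2 : √(n : ℝ) / 2 * g ω ^ 2 + 1 / (2 * √n) =
            (√(n : ℝ) ^ 2 * |g ω| ^ 2 + 1) / (2 * √n) := by
          rw [sq_abs]; field_simp
        rw [h2, le_div_iff₀ (by positivity)]
        nlinarith
    _ = ENNReal.ofReal (√n / 2) * ∫⁻ ω, ENNReal.ofReal (g ω ^ 2) ∂ρ +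
          ENNReal.ofReal (1 / (2 * √n)) := by
        rw [lintegral_add_right _ measurable_const, lintegral_const_mul _ (by fun_prop),
          lintegral_const, measure_univ, mul_one]
    _ ≤ ENNReal.ofReal (√n / 2) * ENNReal.ofReal (1 / n) + ENNReal.ofReal (1 / (2 * √n)) := by
        gcongr
    _ = rate n := by
        rw [← ENNReal.ofReal_mul (by positivity), ← ENNReal.ofReal_add (by positivity)
          (by positivity), rate]
        congr 1
        nth_rewrite 2 [← hsq]
        field_simp
        norm_num

/-- The mean square deviation of the average of independent variables with values in `[0, 1]`. -/
lemma lintegral_sq_average_pi_le {Ω : Type*} [MeasurableSpace Ω] (P : Measure Ω)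
    [IsProbabilityMeasure P] {f : Ω → ℝ} (hf : Measurable f) (h01 : ∀ ω, f ω ∈ Set.Icc (0 : ℝ) 1)
    {n : ℕ} (hn : 1 ≤ n) :
    ∫⁻ x : Fin n → Ω, ENNReal.ofReal ((1 / (n : ℝ) * ∑ i, f (x i) - ∫ ω, f ω ∂P) ^ 2)
      ∂(Measure.pi fun _ => P) ≤ ENNReal.ofReal (1 / n) := by
  have hn0 : (0 : ℝ) < n := by exact_mod_cast hn
  have hL : MemLp f 2 P := MemLp.of_bound hf.aestronglyMeasurable 1 (ae_of_all _ fun ω => by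
    rw [Real.norm_eq_abs, abs_of_nonneg (h01 ω).1]; exact (h01 ω).2)
  set S : (Fin n → Ω) → ℝ := ∑ i, fun x => f (x i) with hS
  have hSx : ∀ x, S x = ∑ i, f (x i) := fun x => by simp [hS]
  have hLi : ∀ i : Fin n, MemLp (fun x : Fin n → Ω => f (x i)) 2 (Measure.pi fun _ => P) :=
    fun i => hL.comp_measurePreserving (measurePreserving_eval (fun _ => P) i)
  have hLS : MemLp S 2 (Measure.pi fun _ => P) := memLp_finsetSum' _ fun i _ => hLi i
  have hvar : Var[S; Measure.pi fun _ => P] = ∑ i : Fin n, Var[f; P] :=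
    variance_sum_pi (X := fun _ => f) fun _ => hL
  have hmean : ∫ x, 1 / (n : ℝ) * S x ∂(Measure.pi fun _ => P) = ∫ ω, f ω ∂P := by
    simp only [hSx]
    rw [integral_const_mul, integral_finsetSum _ fun i _ => (hLi i).integrable (by norm_num)]
    have : ∀ i : Fin n, ∫ x : Fin n → Ω, f (x i) ∂(Measure.pi fun _ => P) = ∫ ω, f ω ∂P :=
      fun i => by
        conv_rhs => rw [← (measurePreserving_eval (fun _ : Fin n => P) i).map_eq]
        rw [integral_map (measurable_pi_apply i).aemeasurable (by fun_prop)]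
    simp only [this]
    simp
    field_simp
  have hV : Var[fun x => 1 / (n : ℝ) * S x; Measure.pi fun _ => P] ≤ 1 / n := by
    rw [variance_const_mul, hvar]
    have : Var[f; P] ≤ 1 := (variance_le_sq_of_bounded (ae_of_all _ h01) hf.aemeasurable).trans
      (by norm_num)
    simp only [Finset.sum_const, Finset.card_univ, Fintype.card_fin, nsmul_eq_mul]
    calc (1 / (n : ℝ)) ^ 2 * (n * Var[f; P]) = 1 / n * Var[f; P] := by field_simp
      _ ≤ 1 / n * 1 := by gcongr
      _ = _ := mul_one _
  have := ENNReal.ofReal_le_ofReal hV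
  rw [(hLS.const_mul _).ofReal_variance_eq, evariance_eq_lintegral_ofReal, hmean] at this
  simpa only [hSx] using this

/-- Distinct positions of a uniformly permuted centred vector are negatively correlated. -/
lemma sum_perm_mul_nonpos {ι : Type*} [Fintype ι] [DecidableEq ι] (a : ι → ℝ)
    (ha : ∑ i, a i = 0) {i j : ι} (hij : i ≠ j) :
    ∑ σ : Equiv.Perm ι, a (σ i) * a (σ j) ≤ 0 := by
  -- Composing `σ` with the transposition of `l` and `j` shows that the sum is the same for all `l ≠
  -- i`. Summed over all `l` it vanishes by centring, so the common off-diagonal value has the sign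
  -- opposite to the diagonal one.
  have hsymm : ∀ l ∈ Finset.univ.erase i, ∑ σ : Equiv.Perm ι, a (σ i) * a (σ l) =
      ∑ σ : Equiv.Perm ι, a (σ i) * a (σ j) := by
    intro l hl
    rw [← Equiv.sum_comp (Equiv.mulRight (Equiv.swap l j))]
    refine Finset.sum_congr rfl fun σ _ => ?_
    simp [Equiv.swap_apply_of_ne_of_ne (Finset.ne_of_mem_erase hl).symm hij]
  have hzero : ∑ l, ∑ σ : Equiv.Perm ι, a (σ i) * a (σ l) = 0 := by
    rw [Finset.sum_comm]
    refine Finset.sum_eq_zero fun σ _ => ?_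
    rw [← Finset.mul_sum, Equiv.sum_comp σ a, ha, mul_zero]
  rw [← Finset.add_sum_erase _ _ (Finset.mem_univ i), Finset.sum_congr rfl hsymm,
    Finset.sum_const, nsmul_eq_mul] at hzero
  have hnn : 0 ≤ ∑ σ : Equiv.Perm ι, a (σ i) * a (σ i) :=
    Finset.sum_nonneg fun σ _ => mul_self_nonneg _
  have hcard : (0 : ℝ) < (Finset.univ.erase i).card := by
    exact_mod_cast Finset.card_pos.2 ⟨j, Finset.mem_erase.2 ⟨hij.symm, Finset.mem_univ _⟩⟩
  nlinarith

/-- The mean square deviation of the average over a sample drawn without replacement. -/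
lemma sum_perm_sq_average_le {k N : ℕ} (hk : 1 ≤ k) (e : Fin k ↪ Fin N) (c : Fin N → ℝ)
    (h01 : ∀ i, c i ∈ Set.Icc (0 : ℝ) 1) :
    ∑ σ : Equiv.Perm (Fin N), (1 / (k : ℝ) * ∑ i, c (σ (e i)) - 1 / (N : ℝ) * ∑ j, c j) ^ 2 ≤
      (Fintype.card (Equiv.Perm (Fin N)) : ℝ) * (1 / k) := by
  have hk0 : (0 : ℝ) < k := by exact_mod_cast hk
  have hN0 : (0 : ℝ) < N := by
    have := Fintype.card_le_of_embedding e
    simp only [Fintype.card_fin] at this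
    exact_mod_cast hk.trans this
  set p := 1 / (N : ℝ) * ∑ j, c j with hp
  set a : Fin N → ℝ := fun j => c j - p with ha
  have hp0 : 0 ≤ p := mul_nonneg (by positivity) (Finset.sum_nonneg fun j _ => (h01 j).1)
  have hp1 : p ≤ 1 := by
    have : ∑ j, c j ≤ ∑ _j : Fin N, (1 : ℝ) := Finset.sum_le_sum fun j _ => (h01 j).2
    simp only [Finset.sum_const, Finset.card_univ, Fintype.card_fin, nsmul_eq_mul, mul_one] at this
    rw [hp, one_div, inv_mul_le_iff₀ hN0]; simpa using this
  have hsum : ∑ j, a j = 0 := by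
    simp only [ha, Finset.sum_sub_distrib, Finset.sum_const, Finset.card_univ, Fintype.card_fin,
      nsmul_eq_mul, hp]
    field_simp; ring
  have ha1 : ∀ j, a j * a j ≤ 1 := fun j => by
    have h1 := (h01 j).1
    have h2 := (h01 j).2
    simp only [ha]; nlinarith
  have hrepr : ∀ σ : Equiv.Perm (Fin N), (1 / (k : ℝ) * ∑ i, c (σ (e i)) - p) ^ 2 =
      (1 / (k : ℝ)) ^ 2 * ∑ i, ∑ j, a (σ (e i)) * a (σ (e j)) := by
    intro σ
    rw [← Finset.sum_mul_sum, ← sq, ← mul_pow]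
    congr 1
    simp only [ha, Finset.sum_sub_distrib, Finset.sum_const, Finset.card_univ, Fintype.card_fin,
      nsmul_eq_mul]
    field_simp
  simp only [hrepr]
  rw [← Finset.mul_sum, Finset.sum_comm]
  -- The diagonal term is at most 1 for each permutation; the off-diagonal ones sum to something
  -- nonpositive.
  have hbound : ∀ i : Fin k, ∑ σ : Equiv.Perm (Fin N), ∑ j, a (σ (e i)) * a (σ (e j)) ≤
      Fintype.card (Equiv.Perm (Fin N)) := by
    intro i
    rw [Finset.sum_comm, ← Finset.add_sum_erase _ _ (Finset.mem_univ i)]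
    have h1 : ∑ σ : Equiv.Perm (Fin N), a (σ (e i)) * a (σ (e i)) ≤
        ∑ _σ : Equiv.Perm (Fin N), (1 : ℝ) := Finset.sum_le_sum fun σ _ => ha1 _
    have h2 : ∑ j ∈ Finset.univ.erase i, ∑ σ : Equiv.Perm (Fin N), a (σ (e i)) * a (σ (e j)) ≤ 0 :=
      Finset.sum_nonpos fun j hj => sum_perm_mul_nonpos a hsum
        fun h => Finset.ne_of_mem_erase hj (e.injective h).symm
    simp only [Finset.sum_const, Finset.card_univ, nsmul_eq_mul, mul_one] at h1
    linarith
  calc _ ≤ (1 / (k : ℝ)) ^ 2 * ∑ _i : Fin k, (Fintype.card (Equiv.Perm (Fin N)) : ℝ) := by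
        gcongr with i; exact hbound i
    _ = _ := by
        simp only [Finset.sum_const, Finset.card_univ, Fintype.card_fin, nsmul_eq_mul]
        field_simp

instance permDiscreteMeasurableSpace (N : ℕ) : DiscreteMeasurableSpace (Equiv.Perm (Fin N)) :=
  ⟨fun _ => trivial⟩

lemma lintegral_perm_abs_average_le {k N : ℕ} (hk : 1 ≤ k) (e : Fin k ↪ Fin N) (c : Fin N → ℝ)
    (h01 : ∀ i, c i ∈ Set.Icc (0 : ℝ) 1) :
    ∫⁻ σ : Equiv.Perm (Fin N),
      ENNReal.ofReal |1 / (k : ℝ) * ∑ i, c (σ (e i)) - 1 / (N : ℝ) * ∑ j, c j|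
      ∂(uniformOn Set.univ) ≤ rate k := by
  refine lintegral_abs_le_rate _ (measurable_of_countable _) hk ?_
  rw [lintegral_fintype]
  have hcard : (0 : ℝ) < Fintype.card (Equiv.Perm (Fin N)) := by exact_mod_cast Fintype.card_pos
  have h1 : ∀ σ : Equiv.Perm (Fin N), uniformOn (Set.univ : Set (Equiv.Perm (Fin N))) {σ} =
      ENNReal.ofReal (1 / Fintype.card (Equiv.Perm (Fin N))) := by
    intro σ
    rw [uniformOn_univ, Measure.count_singleton, ENNReal.ofReal_div_of_pos hcard,
      ENNReal.ofReal_one, ENNReal.ofReal_natCast]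
  simp only [h1]
  rw [← Finset.sum_mul, ← ENNReal.ofReal_sum_of_nonneg (fun _ _ => sq_nonneg _),
    ← ENNReal.ofReal_mul (Finset.sum_nonneg fun _ _ => sq_nonneg _)]
  refine ENNReal.ofReal_le_ofReal ?_
  refine (mul_le_mul_of_nonneg_right (sum_perm_sq_average_le hk e c h01)
    (by positivity)).trans_eq ?_
  field_simp

end Deviations

/-! ### Empirical distributions: expected cell discrepancies and tails -/

section Empirical

variable {d : ℕ}

lemma lintegral_empirical {n : ℕ} (x : Fin n → Pt d) {f : Pt d → ℝ≥0∞} (hf : Measurable f) :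
    ∫⁻ z, f z ∂(empirical x) = (n : ℝ≥0∞)⁻¹ * ∑ i, f (x i) := by
  rw [empirical, lintegral_smul_measure, lintegral_finsetSum_measure, smul_eq_mul]
  simp only [lintegral_dirac' _ hf]

lemma isProbabilityMeasure_empirical {n : ℕ} (hn : 1 ≤ n) (x : Fin n → Pt d) :
    IsProbabilityMeasure (empirical x) := by
  refine ⟨?_⟩
  rw [← setLIntegral_one, Measure.restrict_univ, lintegral_empirical x measurable_const]
  simp only [Finset.sum_const, Finset.card_univ, Fintype.card_fin, nsmul_eq_mul, mul_one]
  exact ENNReal.inv_mul_cancel (by simp; omega) (by simp)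

lemma toReal_empirical {n : ℕ} (x : Fin n → Pt d) {A : Set (Pt d)} (hA : MeasurableSet A) :
    (empirical x A).toReal = 1 / (n : ℝ) * ∑ i, A.indicator 1 (x i) := by
  have : empirical x A = (n : ℝ≥0∞)⁻¹ * ∑ i, A.indicator 1 (x i) := by
    simp [empirical, Measure.dirac_apply' _ hA]
  rw [this, ENNReal.toReal_mul, ENNReal.toReal_sum]
  · congr 1
    · simp
    · refine Finset.sum_congr rfl fun i _ => ?_
      by_cases h : x i ∈ A <;> simp [h]
  · intro i _
    by_cases h : x i ∈ A <;> simp [h]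

lemma indicator_one_mem_Icc {Ω : Type*} (A : Set Ω) (x : Ω) :
    A.indicator (1 : Ω → ℝ) x ∈ Set.Icc (0 : ℝ) 1 := by
  by_cases h : x ∈ A <;> simp [h]

lemma sub_add_sub_eq_ofReal_abs {a b : ℝ≥0∞} (ha : a ≠ ∞) (hb : b ≠ ∞) :
    (a - b) + (b - a) = ENNReal.ofReal |a.toReal - b.toReal| := by
  have key : ∀ a b : ℝ≥0∞, a ≠ ∞ → b ≠ ∞ → a ≤ b →
      (a - b) + (b - a) = ENNReal.ofReal |a.toReal - b.toReal| := by
    intro a b ha hb h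
    rw [tsub_eq_zero_of_le h, zero_add, abs_sub_comm,
      abs_of_nonneg (sub_nonneg.2 (ENNReal.toReal_mono hb h)),
      ENNReal.ofReal_sub _ ENNReal.toReal_nonneg, ENNReal.ofReal_toReal ha,
      ENNReal.ofReal_toReal hb]
  rcases le_total a b with h | h
  · exact key a b ha hb h
  · rw [add_comm, abs_sub_comm]; exact key b a hb ha h

lemma cellDiscrepancy_eq {X : Type*} [MeasurableSpace X] (t : Finset ℕ) (C : ℕ → Set X)
    (μ ν : Measure X) [IsProbabilityMeasure μ] [IsProbabilityMeasure ν] :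
    cellDiscrepancy t C μ ν =
      ∑ i ∈ t, ENNReal.ofReal |(μ (C i)).toReal - (ν (C i)).toReal| :=
  Finset.sum_congr rfl fun _ _ =>
    sub_add_sub_eq_ofReal_abs (measure_ne_top _ _) (measure_ne_top _ _)

lemma measurable_lintegral_empirical {Ω : Type*} [MeasurableSpace Ω] {n : ℕ}
    {x : Ω → Fin n → Pt d} (hx : Measurable x) {f : Pt d → ℝ≥0∞} (hf : Measurable f) :
    Measurable fun ω => ∫⁻ z, f z ∂(empirical (x ω)) := by
  simp only [lintegral_empirical _ hf]
  fun_prop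

lemma measurable_tailMoment_empirical {Ω : Type*} [MeasurableSpace Ω] {n : ℕ} (R : ℝ≥0)
    {x : Ω → Fin n → Pt d} (hx : Measurable x) :
    Measurable fun ω => tailMoment R (empirical (x ω)) := by
  simp only [tailMoment, ← lintegral_indicator measurableSet_closedBall.compl]
  exact measurable_lintegral_empirical hx
    (Measurable.indicator (by fun_prop) measurableSet_closedBall.compl)

lemma measurable_empirical_apply {Ω : Type*} [MeasurableSpace Ω] {n : ℕ}
    {x : Ω → Fin n → Pt d} (hx : Measurable x) {A : Set (Pt d)} (hA : MeasurableSet A) :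
    Measurable fun ω => empirical (x ω) A := by
  simp only [← lintegral_indicator_one hA]
  exact measurable_lintegral_empirical hx (measurable_one.indicator hA)

/-- The tail moment of an empirical distribution is an average over its points, so only their
individual laws matter and no independence is needed. This is what lets it serve permuted samples
too. -/
lemma lintegral_tailMoment_empirical_le {Ω : Type*} [MeasurableSpace Ω] {n : ℕ} (hn : 1 ≤ n)
    (R : ℝ≥0) {x : Ω → Fin n → Pt d} (hx : Measurable x) (ρ : Measure Ω) {M : ℝ≥0∞}
    (h : ∀ i, tailMoment R (ρ.map fun ω => x ω i) ≤ M) :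
    ∫⁻ ω, tailMoment R (empirical (x ω)) ∂ρ ≤ M := by
  have hm : Measurable ((Metric.closedBall (0 : Pt d) (R : ℝ))ᶜ.indicator fun x => ‖x‖ₑ ^ 2) :=
    Measurable.indicator (by fun_prop) measurableSet_closedBall.compl
  have hxi : ∀ i, Measurable fun ω => x ω i := fun i => by fun_prop
  simp only [tailMoment, ← lintegral_indicator measurableSet_closedBall.compl,
    lintegral_empirical _ hm] at h ⊢
  rw [lintegral_const_mul _ (by fun_prop), lintegral_finsetSum _ (fun i _ => by fun_prop)]
  calc _ ≤ (n : ℝ≥0∞)⁻¹ * ∑ _i : Fin n, M := by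
        gcongr with i
        have := h i
        rwa [lintegral_map hm (hxi i)] at this
    _ = ((n : ℝ≥0∞)⁻¹ * n) * M := by
        simp [mul_assoc]
    _ ≤ M := by
        rw [ENNReal.inv_mul_cancel (by simp; omega) (by simp), one_mul]

/-- The expected discrepancy between a law and the empirical distribution of a sample. -/
lemma lintegral_cellDiscrepancy_empirical_le {n : ℕ} (hn : 1 ≤ n) (t : Finset ℕ)
    {C : ℕ → Set (Pt d)} (hC : ∀ i, MeasurableSet (C i)) (P : Measure (Pt d))
    [IsProbabilityMeasure P] :
    ∫⁻ x : Fin n → Pt d, cellDiscrepancy t C (empirical x) P ∂(Measure.pi fun _ => P) ≤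
      t.card * rate n := by
  have hpm := fun x : Fin n → Pt d => isProbabilityMeasure_empirical hn x
  simp only [cellDiscrepancy_eq, toReal_empirical _ (hC _)]
  have hind : ∀ i, Measurable ((C i).indicator (1 : Pt d → ℝ)) :=
    fun i => measurable_one.indicator (hC i)
  rw [lintegral_finsetSum _ (fun i _ => by fun_prop), ← nsmul_eq_mul]
  refine Finset.sum_le_card_nsmul _ _ _ fun i _ => ?_
  refine lintegral_abs_le_rate _ (by fun_prop) hn ?_
  have := lintegral_sq_average_pi_le P (hind i) (indicator_one_mem_Icc _) hn
  rwa [integral_indicator_one (hC i)] at this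

/-- The expected discrepancy between the two parts of a randomly permuted pooled sample. -/
lemma lintegral_perm_cellDiscrepancy_le {m n : ℕ} (hm : 1 ≤ m) (hn : 1 ≤ n) (t : Finset ℕ)
    {C : ℕ → Set (Pt d)} (hC : ∀ i, MeasurableSet (C i)) (x : Fin m → Pt d) (y : Fin n → Pt d) :
    ∫⁻ σ, cellDiscrepancy t C (empirical (permFirst σ x y)) (empirical (permLast σ x y))
      ∂(uniformOn Set.univ) ≤ t.card * (rate m + rate n) := by
  have hpm := fun x : Fin m → Pt d => isProbabilityMeasure_empirical hm x
  have hpn := fun x : Fin n → Pt d => isProbabilityMeasure_empirical hn x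
  simp only [cellDiscrepancy_eq, toReal_empirical _ (hC _)]
  rw [lintegral_finsetSum _ (fun i _ => measurable_of_countable _), ← nsmul_eq_mul]
  refine Finset.sum_le_card_nsmul _ _ _ fun i _ => ?_
  set c : Fin (m + n) → ℝ := fun j => (C i).indicator 1 (Fin.append x y j) with hc
  have h₁ := lintegral_perm_abs_average_le hm (Fin.castAddEmb n) c
    (fun _ => indicator_one_mem_Icc _ _)
  have h₂ := lintegral_perm_abs_average_le hn (Fin.natAddEmb m) c
    (fun _ => indicator_one_mem_Icc _ _)
  refine le_trans ?_ (add_le_add h₁ h₂)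
  rw [← lintegral_add_left (measurable_of_countable _)]
  refine lintegral_mono fun σ => ?_
  rw [← ENNReal.ofReal_add (abs_nonneg _) (abs_nonneg _)]
  refine ENNReal.ofReal_le_ofReal ?_
  -- Both parts are compared with the frequency in the pooled sample.
  refine (abs_sub_le _ (1 / ((m + n : ℕ) : ℝ) * ∑ j, c j) _).trans ?_
  rw [abs_sub_comm (1 / ((m + n : ℕ) : ℝ) * ∑ j, c j)]
  exact le_rfl

/-- The law of the samples of one client. -/
noncomputable abbrev clientLaw (m n : ℕ) (P Q : Measure (Pt d)) :
    Measure ((Fin m → Pt d) × (Fin n → Pt d)) :=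
  (Measure.pi fun _ => P).prod (Measure.pi fun _ => Q)

lemma map_append_clientLaw (m n : ℕ) (P Q : Measure (Pt d)) [IsProbabilityMeasure P]
    [IsProbabilityMeasure Q] (j : Fin (m + n)) :
    (clientLaw m n P Q).map (fun D => Fin.append D.1 D.2 j) = P ∨
      (clientLaw m n P Q).map (fun D => Fin.append D.1 D.2 j) = Q := by
  refine Fin.addCases (fun i => Or.inl ?_) (fun i => Or.inr ?_) j
  · simp only [Fin.append_left]
    exact ((measurePreserving_eval (fun _ : Fin m => P) i).comp measurePreserving_fst).map_eq
  · simp only [Fin.append_right]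
    exact ((measurePreserving_eval (fun _ : Fin n => Q) i).comp measurePreserving_snd).map_eq

lemma measurable_append (m n : ℕ) (j : Fin (m + n)) :
    Measurable fun D : (Fin m → Pt d) × (Fin n → Pt d) => Fin.append D.1 D.2 j := by
  refine Fin.addCases (fun i => ?_) (fun i => ?_) j
  · simp only [Fin.append_left]; fun_prop
  · simp only [Fin.append_right]; fun_prop

lemma measurable_permFirst {m n : ℕ} (σ : Equiv.Perm (Fin (m + n))) :
    Measurable fun D : (Fin m → Pt d) × (Fin n → Pt d) => permFirst σ D.1 D.2 :=
  measurable_pi_lambda _ fun _ => measurable_append m n _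

lemma measurable_permLast {m n : ℕ} (σ : Equiv.Perm (Fin (m + n))) :
    Measurable fun D : (Fin m → Pt d) × (Fin n → Pt d) => permLast σ D.1 D.2 :=
  measurable_pi_lambda _ fun _ => measurable_append m n _

lemma tailMoment_map_append_le (R : ℝ≥0) {m n : ℕ} (P Q : Measure (Pt d)) [IsProbabilityMeasure P]
    [IsProbabilityMeasure Q] (j : Fin (m + n)) :
    tailMoment R ((clientLaw m n P Q).map fun D => Fin.append D.1 D.2 j) ≤
      tailMoment R P + tailMoment R Q := by
  rcases map_append_clientLaw m n P Q j with h | h <;> rw [h]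
  · exact le_self_add
  · exact le_add_self

end Empirical

/-! ### Expected values of the cell bound -/

section Bounds

variable {d : ℕ}

/-- The bound on the transport cost given by a cell partition. -/
noncomputable def cellBound (R ε : ℝ≥0) (t : Finset ℕ) (C : ℕ → Set (Pt d))
    (μ ν : Measure (Pt d)) : ℝ≥0∞ :=
  (ε : ℝ≥0∞) ^ 2 + 2 * (R : ℝ≥0∞) ^ 2 * cellDiscrepancy t C μ ν +
      2 * (tailMoment R μ + tailMoment R ν)

/-- The bound on the expected transport costs, up to the tails. -/
noncomputable def mainError (R ε : ℝ≥0) (t : Finset ℕ) (m n : ℕ) : ℝ≥0∞ :=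
  2 * (ε : ℝ≥0∞) ^ 2 + 2 * (R : ℝ≥0∞) ^ 2 * (t.card * (rate m + rate n))

lemma measurable_cellBound_perm {m n : ℕ} (R ε : ℝ≥0) (t : Finset ℕ) {C : ℕ → Set (Pt d)}
    (hC : ∀ i, MeasurableSet (C i)) :
    Measurable fun p : ((Fin m → Pt d) × (Fin n → Pt d)) × Equiv.Perm (Fin (m + n)) =>
      cellBound R ε t C (empirical (permFirst p.2 p.1.1 p.1.2))
        (empirical (permLast p.2 p.1.1 p.1.2)) := by
  refine measurable_from_prod_countable_left fun σ => ?_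
  have h₁ := fun i => measurable_empirical_apply (measurable_permFirst (d := d) σ) (hC i)
  have h₂ := fun i => measurable_empirical_apply (measurable_permLast (d := d) σ) (hC i)
  have h₃ := measurable_tailMoment_empirical R (measurable_permFirst (d := d) σ)
  have h₄ := measurable_tailMoment_empirical R (measurable_permLast (d := d) σ)
  simp only [cellBound, cellDiscrepancy]
  fun_prop

lemma measurable_cellBound_sample {n : ℕ} (R ε : ℝ≥0) (t : Finset ℕ) {C : ℕ → Set (Pt d)}
    (hC : ∀ i, MeasurableSet (C i)) (P : Measure (Pt d)) :
    Measurable fun x : Fin n → Pt d => cellBound R ε t C (empirical x) P := by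
  have h₁ := fun i => measurable_empirical_apply
    (measurable_id : Measurable fun x : Fin n → Pt d => x) (hC i)
  have h₃ := measurable_tailMoment_empirical R
    (measurable_id : Measurable fun x : Fin n → Pt d => x)
  simp only [cellBound, cellDiscrepancy]
  fun_prop

lemma lintegral_cellBound_le {Ω : Type*} [MeasurableSpace Ω] (ρ : Measure Ω)
    [IsProbabilityMeasure ρ] (R ε : ℝ≥0) (t : Finset ℕ) {C : ℕ → Set (Pt d)}
    {μ ν : Ω → Measure (Pt d)} (h₁ : Measurable fun ω => cellDiscrepancy t C (μ ω) (ν ω))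
    (h₂ : Measurable fun ω => tailMoment R (μ ω)) (h₃ : Measurable fun ω => tailMoment R (ν ω))
    {a b c : ℝ≥0∞} (ha : ∫⁻ ω, cellDiscrepancy t C (μ ω) (ν ω) ∂ρ ≤ a)
    (hb : ∫⁻ ω, tailMoment R (μ ω) ∂ρ ≤ b) (hc : ∫⁻ ω, tailMoment R (ν ω) ∂ρ ≤ c) :
    ∫⁻ ω, cellBound R ε t C (μ ω) (ν ω) ∂ρ ≤
      (ε : ℝ≥0∞) ^ 2 + 2 * (R : ℝ≥0∞) ^ 2 * a + 2 * (b + c) := by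
  simp only [cellBound]
  rw [lintegral_add_left (by fun_prop), lintegral_add_left (by fun_prop),
    lintegral_const_mul _ (by fun_prop), lintegral_const_mul _ (by fun_prop),
    lintegral_add_left (by fun_prop), lintegral_const, measure_univ, mul_one]
  gcongr

lemma lintegral_cellBound_sample_le {n : ℕ} (hn : 1 ≤ n) (R ε : ℝ≥0) (t : Finset ℕ)
    {C : ℕ → Set (Pt d)} (hC : ∀ i, MeasurableSet (C i)) (P : Measure (Pt d))
    [IsProbabilityMeasure P] :
    ∫⁻ x : Fin n → Pt d, cellBound R ε t C (empirical x) P ∂(Measure.pi fun _ => P) ≤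
      (ε : ℝ≥0∞) ^ 2 + 2 * (R : ℝ≥0∞) ^ 2 * (t.card * rate n) + 4 * tailMoment R P := by
  have h₁ := fun i => measurable_empirical_apply
    (measurable_id : Measurable fun x : Fin n → Pt d => x) (hC i)
  have h₃ := measurable_tailMoment_empirical R
    (measurable_id : Measurable fun x : Fin n → Pt d => x)
  have hcell : Measurable fun x : Fin n → Pt d => cellDiscrepancy t C (empirical x) P := by
    simp only [cellDiscrepancy]; fun_prop
  have ht := lintegral_tailMoment_empirical_le hn R
    (measurable_id : Measurable fun x : Fin n → Pt d => x) (Measure.pi fun _ => P)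
    (M := tailMoment R P) fun i => by
      rw [show (fun ω : Fin n → Pt d => id ω i) = Function.eval i from rfl,
        (measurePreserving_eval (fun _ : Fin n => P) i).map_eq]
  refine (lintegral_cellBound_le _ R ε t (C := C) hcell h₃ measurable_const
    (lintegral_cellDiscrepancy_empirical_le hn t hC P) ht
    (c := tailMoment R P) (by simp)).trans_eq ?_
  ring

/-- The two kinds of terms use opposite orders of integration. For the tails the permutation is
fixed and the data are integrated, every pooled point having law `P` or `Q`; for the discrepancies
the data are fixed and the permutation is averaged. Each part can carry the tails of both laws,
hence the factor 4. -/
lemma lintegral_cellBound_perm_le {m n : ℕ} (hm : 1 ≤ m) (hn : 1 ≤ n) (R ε : ℝ≥0) (t : Finset ℕ)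
    {C : ℕ → Set (Pt d)} (hC : ∀ i, MeasurableSet (C i)) (P Q : Measure (Pt d))
    [IsProbabilityMeasure P] [IsProbabilityMeasure Q] :
    ∫⁻ p : ((Fin m → Pt d) × (Fin n → Pt d)) × Equiv.Perm (Fin (m + n)),
      cellBound R ε t C (empirical (permFirst p.2 p.1.1 p.1.2))
        (empirical (permLast p.2 p.1.1 p.1.2)) ∂((clientLaw m n P Q).prod (uniformOn Set.univ)) ≤
      (ε : ℝ≥0∞) ^ 2 + 2 * (R : ℝ≥0∞) ^ 2 * (t.card * (rate m + rate n)) +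
        4 * (tailMoment R P + tailMoment R Q) := by
  have hcell : Measurable fun p : ((Fin m → Pt d) × (Fin n → Pt d)) × Equiv.Perm (Fin (m + n)) =>
      cellDiscrepancy t C (empirical (permFirst p.2 p.1.1 p.1.2))
        (empirical (permLast p.2 p.1.1 p.1.2)) := by
    refine measurable_from_prod_countable_left fun σ => ?_
    have h₁ := fun i => measurable_empirical_apply (measurable_permFirst (d := d) σ) (hC i)
    have h₂ := fun i => measurable_empirical_apply (measurable_permLast (d := d) σ) (hC i)
    simp only [cellDiscrepancy]
    fun_prop
  have hm₁ := fun σ : Equiv.Perm (Fin (m + n)) =>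
    measurable_tailMoment_empirical R (measurable_permFirst (d := d) σ)
  have hm₂ := fun σ : Equiv.Perm (Fin (m + n)) =>
    measurable_tailMoment_empirical R (measurable_permLast (d := d) σ)
  have htail₁ : Measurable fun p : ((Fin m → Pt d) × (Fin n → Pt d)) × Equiv.Perm (Fin (m + n)) =>
      tailMoment R (empirical (permFirst p.2 p.1.1 p.1.2)) :=
    measurable_from_prod_countable_left hm₁
  have htail₂ : Measurable fun p : ((Fin m → Pt d) × (Fin n → Pt d)) × Equiv.Perm (Fin (m + n)) =>
      tailMoment R (empirical (permLast p.2 p.1.1 p.1.2)) :=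
    measurable_from_prod_countable_left hm₂
  have i₁ : ∫⁻ p, tailMoment R (empirical (permFirst p.2 p.1.1 p.1.2))
      ∂((clientLaw m n P Q).prod (uniformOn Set.univ)) ≤ tailMoment R P + tailMoment R Q := by
    rw [lintegral_prod_symm _ htail₁.aemeasurable]
    refine (lintegral_mono fun σ => lintegral_tailMoment_empirical_le hm R
      (measurable_permFirst (d := d) σ) (clientLaw m n P Q) fun i =>
        tailMoment_map_append_le R P Q _).trans ?_
    simp
  have i₂ : ∫⁻ p, tailMoment R (empirical (permLast p.2 p.1.1 p.1.2))
      ∂((clientLaw m n P Q).prod (uniformOn Set.univ)) ≤ tailMoment R P + tailMoment R Q := by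
    rw [lintegral_prod_symm _ htail₂.aemeasurable]
    refine (lintegral_mono fun σ => lintegral_tailMoment_empirical_le hn R
      (measurable_permLast (d := d) σ) (clientLaw m n P Q) fun i =>
        tailMoment_map_append_le R P Q _).trans ?_
    simp
  have i₃ : ∫⁻ p, cellDiscrepancy t C (empirical (permFirst p.2 p.1.1 p.1.2))
      (empirical (permLast p.2 p.1.1 p.1.2)) ∂((clientLaw m n P Q).prod (uniformOn Set.univ)) ≤
      t.card * (rate m + rate n) := by
    have hprod := lintegral_prod (μ := clientLaw m n P Q)
      (ν := uniformOn (Set.univ : Set (Equiv.Perm (Fin (m + n))))) _ hcell.aemeasurable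
    have hinner : ∀ D : (Fin m → Pt d) × (Fin n → Pt d), ∫⁻ σ, cellDiscrepancy t C
        (empirical (permFirst σ D.1 D.2)) (empirical (permLast σ D.1 D.2)) ∂(uniformOn Set.univ) ≤
        t.card * (rate m + rate n) :=
      fun D => lintegral_perm_cellDiscrepancy_le hm hn t hC D.1 D.2
    rw [hprod]
    refine (lintegral_mono hinner).trans ?_
    rw [lintegral_const, measure_univ, mul_one]
  refine (lintegral_cellBound_le _ R ε t hcell htail₁ htail₂ i₃ i₁ i₂).trans_eq ?_
  ring

end Bounds

/-! ### Critical value, failure events and a lower bound on the power -/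

section Power

/-- The level `z` itself belongs to the set whose infimum is taken, because the rounds below `z` are
the complement of those at or above it. -/
lemma criticalValue_le {B : ℕ} {α : ℝ} (hα : α < 1) {T : Fin B → ℝ} (hT : ∀ b, 0 ≤ T b) {z : ℝ}
    (hz : (1 / (B : ℝ)) * ∑ b, (if z ≤ T b then (1 : ℝ) else 0) ≤ α) (hB : 1 ≤ B) :
    criticalValue α T ≤ z := by
  classical
  have hB0 : (0 : ℝ) < B := by exact_mod_cast hB
  -- A real infimum is meaningful only if the set is bounded below: at a negative level no round
  -- counts, and the fraction 0 is less than `1 - α`.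
  refine csInf_le ⟨0, ?_⟩ ?_
  · intro y hy
    by_contra hneg
    rw [Set.mem_ofPred_eq, Finset.sum_eq_zero, mul_zero] at hy
    · linarith
    · intro b _
      rw [if_neg]
      have := hT b
      linarith
  · have h : (1 / (B : ℝ)) * ∑ b, (if T b < z then (1 : ℝ) else 0) =
        1 - (1 / (B : ℝ)) * ∑ b, (if z ≤ T b then (1 : ℝ) else 0) := by
      have : ∀ b, (if T b < z then (1 : ℝ) else 0) = 1 - (if z ≤ T b then (1 : ℝ) else 0) := by
        intro b
        by_cases hb : T b < z
        · simp [hb, not_le.2 hb]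
        · simp [hb, not_lt.1 hb]
      simp only [this, Finset.sum_sub_distrib, Finset.sum_const, Finset.card_univ,
        Fintype.card_fin, nsmul_eq_mul]
      field_simp
    have : 1 - α ≤ (1 / (B : ℝ)) * ∑ b, (if T b < z then (1 : ℝ) else 0) := by
      rw [h]; linarith
    rw [Set.mem_ofPred_eq]
    exact this.trans_eq (by congr!)

variable {d : ℕ}

lemma itdSq_equalWeights {K : ℕ} (P Q : Fin K → Measure (Pt d)) :
    itdSq (equalWeights K) P Q = 1 / (K : ℝ) * ∑ k, (transportCost (P k) (Q k)).toReal := by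
  simp only [itdSq, equalWeights, toReal_wasserstein_two_sq, Finset.mul_sum]

lemma ofReal_itdSq_le {K : ℕ} (hK : 0 < K) (P Q : Fin K → Measure (Pt d)) :
    ENNReal.ofReal (itdSq (equalWeights K) P Q) ≤
      (K : ℝ≥0∞)⁻¹ * ∑ k, transportCost (P k) (Q k) := by
  have hK0 : (0 : ℝ) < K := by exact_mod_cast hK
  rw [itdSq_equalWeights, ENNReal.ofReal_mul (by positivity),
    ENNReal.ofReal_sum_of_nonneg (fun _ _ => ENNReal.toReal_nonneg), one_div,
    ENNReal.ofReal_inv_of_pos hK0, ENNReal.ofReal_natCast]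
  gcongr with k
  exact ENNReal.ofReal_toReal_le

/-- Finiteness matters in this direction only: `toReal` turns an infinite cost into 0. -/
lemma le_ofReal_itdSq {K : ℕ} (hK : 0 < K) (P Q : Fin K → Measure (Pt d))
    (h : ∀ k, transportCost (P k) (Q k) ≠ ∞) :
    (K : ℝ≥0∞)⁻¹ * ∑ k, transportCost (P k) (Q k) ≤
      ENNReal.ofReal (itdSq (equalWeights K) P Q) := by
  have hK0 : (0 : ℝ) < K := by exact_mod_cast hK
  rw [itdSq_equalWeights, ENNReal.ofReal_mul (by positivity),
    ENNReal.ofReal_sum_of_nonneg (fun _ _ => ENNReal.toReal_nonneg), one_div,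
    ENNReal.ofReal_inv_of_pos hK0, ENNReal.ofReal_natCast]
  gcongr with k
  rw [ENNReal.ofReal_toReal (h k)]

lemma itdSq_equalWeights_nonneg {K : ℕ} (P Q : Fin K → Measure (Pt d)) :
    0 ≤ itdSq (equalWeights K) P Q := by
  rw [itdSq_equalWeights]
  exact mul_nonneg (by positivity) (Finset.sum_nonneg fun _ _ => ENNReal.toReal_nonneg)

/-- Measures with finite second moments have a finite transport cost. -/
lemma transportCost_ne_top (μ ν : Measure (Pt d)) [IsProbabilityMeasure μ]
    [IsProbabilityMeasure ν] (hμ : ∫⁻ x, ‖x‖ₑ ^ 2 ∂μ ≠ ∞) (hν : ∫⁻ x, ‖x‖ₑ ^ 2 ∂ν ≠ ∞) :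
    transportCost μ ν ≠ ∞ := by
  refine ne_top_of_le_ne_top ?_
    (transportCost_le_of_partial_coupling (γ := 0) (μ' := μ) (ν' := ν) (by simp) (by simp))
  rw [lintegral_zero_measure, zero_add]
  exact ENNReal.add_ne_top.2 ⟨ENNReal.mul_ne_top (by simp) hμ, ENNReal.mul_ne_top (by simp) hν⟩

lemma transportCost_empirical_ne_top {m n : ℕ} (hm : 1 ≤ m) (hn : 1 ≤ n) (x : Fin m → Pt d)
    (y : Fin n → Pt d) : transportCost (empirical x) (empirical y) ≠ ∞ := by
  have key : ∀ {n : ℕ} (_ : 1 ≤ n) (x : Fin n → Pt d), ∫⁻ z, ‖z‖ₑ ^ 2 ∂(empirical x) ≠ ∞ := by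
    intro n hn x
    rw [lintegral_empirical x (by fun_prop)]
    exact ENNReal.mul_ne_top (by simp; omega) (by simp)
  have := isProbabilityMeasure_empirical hm x
  have := isProbabilityMeasure_empirical hn y
  exact transportCost_ne_top _ _ (key hm x) (key hn y)

section Law

variable {K m n B : ℕ} {Bk : Fin K → ℕ} (P Q : Fin K → Measure (Pt d))
  [∀ k, IsProbabilityMeasure (P k)] [∀ k, IsProbabilityMeasure (Q k)]

instance isProbabilityMeasure_experimentLaw [∀ k, Nonempty (Fin (Bk k))] :
    IsProbabilityMeasure (experimentLaw m n B Bk P Q) := by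
  unfold experimentLaw
  infer_instance

/-- The data of a client together with a permutation selected by the server. -/
lemma measurePreserving_selected [∀ k, Nonempty (Fin (Bk k))] (b : Fin B) (k : Fin K) :
    MeasurePreserving
      (fun ω : Data d m n K × Perms m n Bk × Selections B Bk => (ω.1 k, ω.2.1 k (ω.2.2 b k)))
      (experimentLaw m n B Bk P Q) ((clientLaw m n (P k) (Q k)).prod (uniformOn Set.univ)) := by
  have hsel : MeasurePreserving (fun p : Perms m n Bk × Selections B Bk => p.1 k (p.2 b k))
      ((Measure.pi fun _ => Measure.pi fun _ => uniformOn Set.univ).prod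
        (Measure.pi fun _ => Measure.pi fun _ => uniformOn Set.univ))
      (uniformOn (Set.univ : Set (Equiv.Perm (Fin (m + n))))) := by
    refine ⟨measurable_of_countable _, Measure.ext_of_lintegral _ fun f hf => ?_⟩
    rw [lintegral_map hf (measurable_of_countable _),
      lintegral_prod_symm _ (measurable_of_countable _).aemeasurable]
    -- Whatever the selection, the permutation picked is one coordinate of a product of uniform
    -- laws; averaging over the selection therefore changes nothing.
    have hinner : ∀ s : Selections B Bk,
        ∫⁻ σ : Perms m n Bk, f (σ k (s b k))
          ∂(Measure.pi fun _ => Measure.pi fun _ => uniformOn Set.univ) =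
        ∫⁻ τ, f τ ∂(uniformOn (Set.univ : Set (Equiv.Perm (Fin (m + n))))) := by
      intro s
      have h := (measurePreserving_eval (fun _ : Fin (Bk k) =>
        uniformOn (Set.univ : Set (Equiv.Perm (Fin (m + n))))) (s b k)).comp
          (measurePreserving_eval (fun k : Fin K => Measure.pi fun _ : Fin (Bk k) =>
            uniformOn (Set.univ : Set (Equiv.Perm (Fin (m + n))))) k)
      exact h.lintegral_comp hf
    simp only [hinner]
    rw [lintegral_const, measure_univ, mul_one]
  exact (measurePreserving_eval (fun k : Fin K => clientLaw m n (P k) (Q k)) k).prod hsel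

lemma measurePreserving_client [∀ k, Nonempty (Fin (Bk k))] (k : Fin K) :
    MeasurePreserving (fun ω : Data d m n K × Perms m n Bk × Selections B Bk => ω.1 k)
      (experimentLaw m n B Bk P Q) (clientLaw m n (P k) (Q k)) :=
  (measurePreserving_eval (fun k : Fin K => clientLaw m n (P k) (Q k)) k).comp
    measurePreserving_fst

end Law

/-- The factor in the bound on the probability of not rejecting. -/
noncomputable def errorFactor (α δ : ℝ) : ℝ≥0∞ :=
  4 / ENNReal.ofReal (δ / 2) + 1 / ENNReal.ofReal (α * (δ / 8))

lemma errorFactor_ne_top {α δ : ℝ} (hα : 0 < α) (hδ : 0 < δ) : errorFactor α δ ≠ ∞ := by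
  have h : 0 < α * (δ / 8) := by positivity
  refine ENNReal.add_ne_top.2 ⟨ENNReal.div_ne_top (by simp) ?_, ENNReal.div_ne_top (by simp) ?_⟩
  · simpa using hδ
  · simpa using h

section Events

variable {K m n B : ℕ} {Bk : Fin K → ℕ} {P Q : Fin K → Measure (Pt d)}
  [∀ k, IsProbabilityMeasure (P k)] [∀ k, IsProbabilityMeasure (Q k)]
  [∀ k, Nonempty (Fin (Bk k))]
  {R ε : ℝ≥0} {t : Finset ℕ} {C : ℕ → Set (Pt d)}

/-- The average over the clients of the error bounds. -/
noncomputable def averageError (R ε : ℝ≥0) (t : Finset ℕ) (m n : ℕ)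
    (P Q : Fin K → Measure (Pt d)) : ℝ≥0∞ :=
  (K : ℝ≥0∞)⁻¹ * ∑ k, (mainError R ε t m n + 4 * (tailMoment R (P k) + tailMoment R (Q k)))

/-- The test statistic is rarely small. -/
lemma measure_statistic_lt_le (hC : IsCellPartition R ε t C) (hK : 0 < K) (hm : 1 ≤ m)
    (hn : 1 ≤ n) {δ : ℝ} (hδ : 0 < δ) (h : δ ≤ itdSq (equalWeights K) P Q) :
    experimentLaw m n B Bk P Q {ω | statistic (equalWeights K) ω.1 < δ / 8} ≤
      4 / ENNReal.ofReal (δ / 2) * averageError R ε t m n P Q := by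
  set U : Fin K → (Fin m → Pt d) × (Fin n → Pt d) → ℝ≥0∞ := fun k D =>
    cellBound R ε t C (empirical D.1) (P k) + cellBound R ε t C (empirical D.2) (Q k) with hU
  have hU₁ : ∀ k, Measurable fun D : (Fin m → Pt d) × (Fin n → Pt d) =>
      cellBound R ε t C (empirical D.1) (P k) :=
    fun k => (measurable_cellBound_sample R ε t hC.measurableSet (P k)).comp measurable_fst
  have hU₂ : ∀ k, Measurable fun D : (Fin m → Pt d) × (Fin n → Pt d) =>
      cellBound R ε t C (empirical D.2) (Q k) :=
    fun k => (measurable_cellBound_sample R ε t hC.measurableSet (Q k)).comp measurable_snd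
  have hUm : ∀ k, Measurable (U k) := fun k => (hU₁ k).add (hU₂ k)
  have hδ0 : ENNReal.ofReal (δ / 2) ≠ 0 := by simpa using hδ
  have hUi : ∀ k, ∫⁻ ω, U k (ω.1 k) ∂(experimentLaw m n B Bk P Q) ≤
      mainError R ε t m n + 4 * (tailMoment R (P k) + tailMoment R (Q k)) := by
    intro k
    have e := (measurePreserving_client (m := m) (n := n) (B := B) (Bk := Bk) P Q
      k).lintegral_comp (hUm k)
    rw [e, hU, lintegral_add_left (hU₁ k)]
    have e₁ := (measurePreserving_fst (μ := Measure.pi fun _ : Fin m => P k)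
      (ν := Measure.pi fun _ : Fin n => Q k)).lintegral_comp
        (measurable_cellBound_sample R ε t hC.measurableSet (P k))
    have e₂ := (measurePreserving_snd (μ := Measure.pi fun _ : Fin m => P k)
      (ν := Measure.pi fun _ : Fin n => Q k)).lintegral_comp
        (measurable_cellBound_sample R ε t hC.measurableSet (Q k))
    rw [e₁, e₂]
    refine (add_le_add (lintegral_cellBound_sample_le hm R ε t hC.measurableSet (P k))
      (lintegral_cellBound_sample_le hn R ε t hC.measurableSet (Q k))).trans_eq ?_
    rw [mainError]; ring
  -- If the statistic is below `δ / 8`, its share `4 * (δ / 8) = δ / 2` in the triangle inequality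
  -- leaves at least `δ / 2` to the sampling errors.
  have hsub : {ω : Data d m n K × Perms m n Bk × Selections B Bk |
      statistic (equalWeights K) ω.1 < δ / 8} ⊆
      {ω | ENNReal.ofReal (δ / 2) ≤ 4 * ((K : ℝ≥0∞)⁻¹ * ∑ k, U k (ω.1 k))} := by
    intro ω hω
    rw [Set.mem_ofPred_eq] at hω ⊢
    -- Two uses of the triangle inequality give factors 2, 4 and 4; the first is weakened to 4 for
    -- symmetry.
    have htri : ∀ k, transportCost (P k) (Q k) ≤ 4 * U k (ω.1 k) +
        4 * transportCost (empirical (ω.1 k).1) (empirical (ω.1 k).2) := by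
      intro k
      have := isProbabilityMeasure_empirical hm (ω.1 k).1
      have := isProbabilityMeasure_empirical hn (ω.1 k).2
      calc _ ≤ 2 * transportCost (P k) (empirical (ω.1 k).1) +
            2 * (2 * transportCost (empirical (ω.1 k).1) (empirical (ω.1 k).2) +
              2 * transportCost (empirical (ω.1 k).2) (Q k)) :=
            (transportCost_triangle _ (empirical (ω.1 k).1) _).trans
              (add_le_add le_rfl (mul_le_mul' le_rfl (transportCost_triangle _ _ _)))
        _ ≤ 4 * transportCost (P k) (empirical (ω.1 k).1) +
            2 * (2 * transportCost (empirical (ω.1 k).1) (empirical (ω.1 k).2) +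
              2 * transportCost (empirical (ω.1 k).2) (Q k)) := by
            gcongr; norm_num
        _ = 4 * (transportCost (empirical (ω.1 k).1) (P k) +
              transportCost (empirical (ω.1 k).2) (Q k)) +
            4 * transportCost (empirical (ω.1 k).1) (empirical (ω.1 k).2) := by
            rw [transportCost_comm (P k)]; ring
        _ ≤ _ := by
            gcongr
            exact add_le_add (hC.transportCost_le _ _) (hC.transportCost_le _ _)
    have hstat : (K : ℝ≥0∞)⁻¹ * ∑ k, transportCost (empirical (ω.1 k).1) (empirical (ω.1 k).2) ≤
        ENNReal.ofReal (δ / 8) :=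
      (le_ofReal_itdSq hK _ _ fun k => transportCost_empirical_ne_top hm hn _ _).trans
        (ENNReal.ofReal_le_ofReal hω.le)
    have hδle : ENNReal.ofReal δ ≤ 4 * ((K : ℝ≥0∞)⁻¹ * ∑ k, U k (ω.1 k)) +
        ENNReal.ofReal (δ / 2) := by
      calc ENNReal.ofReal δ ≤ (K : ℝ≥0∞)⁻¹ * ∑ k, transportCost (P k) (Q k) :=
            (ENNReal.ofReal_le_ofReal h).trans (ofReal_itdSq_le hK _ _)
        _ ≤ (K : ℝ≥0∞)⁻¹ * ∑ k, (4 * U k (ω.1 k) +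
            4 * transportCost (empirical (ω.1 k).1) (empirical (ω.1 k).2)) := by
            gcongr with k; exact htri k
        _ = 4 * ((K : ℝ≥0∞)⁻¹ * ∑ k, U k (ω.1 k)) + 4 * ((K : ℝ≥0∞)⁻¹ *
            ∑ k, transportCost (empirical (ω.1 k).1) (empirical (ω.1 k).2)) := by
            rw [Finset.sum_add_distrib, ← Finset.mul_sum, ← Finset.mul_sum]; ring
        _ ≤ 4 * ((K : ℝ≥0∞)⁻¹ * ∑ k, U k (ω.1 k)) + 4 * ENNReal.ofReal (δ / 8) := by
            gcongr
        _ = _ := by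
            congr 1
            rw [← ENNReal.ofReal_ofNat, ← ENNReal.ofReal_mul (by norm_num)]
            congr 1; ring
    have hsplit : ENNReal.ofReal δ = ENNReal.ofReal (δ / 2) + ENNReal.ofReal (δ / 2) := by
      rw [← ENNReal.ofReal_add (by positivity) (by positivity), add_halves]
    rw [hsplit] at hδle
    exact (ENNReal.add_le_add_iff_right ENNReal.ofReal_ne_top).1 hδle
  have hUω : ∀ k, Measurable fun ω : Data d m n K × Perms m n Bk × Selections B Bk =>
      U k (ω.1 k) := fun k => (hUm k).comp (by fun_prop)
  refine (measure_mono hsub).trans ((meas_ge_le_lintegral_div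
    (Measurable.aemeasurable (by fun_prop)) hδ0 ENNReal.ofReal_ne_top).trans ?_)
  rw [lintegral_const_mul _ (by fun_prop), lintegral_const_mul _ (by fun_prop),
    lintegral_finsetSum _ (fun k _ => hUω k), ENNReal.mul_div_right_comm, averageError]
  gcongr with k
  exact hUi k

/-- The permuted statistics are rarely large for more than a fraction `α` of the rounds. -/
lemma measure_permStatistic_ge_le (hC : IsCellPartition R ε t C) (hK : 0 < K) (hm : 1 ≤ m)
    (hn : 1 ≤ n) {α z : ℝ} (hα : 0 < α) (hz : 0 < z) (hB : 1 ≤ B) :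
    experimentLaw m n B Bk P Q {ω | α < (1 / (B : ℝ)) *
      ∑ b, (if z ≤ permStatistic (equalWeights K) ω.1 ω.2.1 ω.2.2 b then (1 : ℝ) else 0)} ≤
      1 / ENNReal.ofReal (α * z) * averageError R ε t m n P Q := by
  have hB0 : (0 : ℝ) < B := by exact_mod_cast hB
  have hαz : ENNReal.ofReal (α * z) ≠ 0 := by
    have : 0 < α * z := by positivity
    simpa using this
  set G : ((Fin m → Pt d) × (Fin n → Pt d)) × Equiv.Perm (Fin (m + n)) → ℝ≥0∞ := fun p =>
    cellBound R ε t C (empirical (permFirst p.2 p.1.1 p.1.2))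
      (empirical (permLast p.2 p.1.1 p.1.2)) with hG
  have hGm : Measurable G := measurable_cellBound_perm R ε t hC.measurableSet
  have hGω : ∀ (b : Fin B) (k : Fin K),
      Measurable fun ω : Data d m n K × Perms m n Bk × Selections B Bk =>
        G (ω.1 k, ω.2.1 k (ω.2.2 b k)) := fun b k =>
    hGm.comp (measurePreserving_selected (m := m) (n := n) P Q b k).measurable
  have hGi : ∀ (b : Fin B) (k : Fin K),
      ∫⁻ ω, G (ω.1 k, ω.2.1 k (ω.2.2 b k)) ∂(experimentLaw m n B Bk P Q) ≤
        mainError R ε t m n + 4 * (tailMoment R (P k) + tailMoment R (Q k)) := by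
    intro b k
    rw [(measurePreserving_selected (m := m) (n := n) P Q b k).lintegral_comp hGm]
    refine (lintegral_cellBound_perm_le hm hn R ε t hC.measurableSet (P k) (Q k)).trans ?_
    -- `mainError` has `2 * ε ^ 2` because the unpermuted statistic needs two cell bounds; here one
    -- is enough.
    rw [mainError]
    gcongr
    exact le_mul_of_one_le_left zero_le (by norm_num)
  have hT : ∀ (ω : Data d m n K × Perms m n Bk × Selections B Bk) (b : Fin B),
      ENNReal.ofReal (permStatistic (equalWeights K) ω.1 ω.2.1 ω.2.2 b) ≤
        (K : ℝ≥0∞)⁻¹ * ∑ k, G (ω.1 k, ω.2.1 k (ω.2.2 b k)) := by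
    intro ω b
    refine (ofReal_itdSq_le hK _ _).trans ?_
    gcongr with k
    have := isProbabilityMeasure_empirical hm (permFirst (ω.2.1 k (ω.2.2 b k)) (ω.1 k).1 (ω.1 k).2)
    have := isProbabilityMeasure_empirical hn (permLast (ω.2.1 k (ω.2.2 b k)) (ω.1 k).1 (ω.1 k).2)
    exact hC.transportCost_le _ _
  have hsub : {ω : Data d m n K × Perms m n Bk × Selections B Bk | α < (1 / (B : ℝ)) *
      ∑ b, (if z ≤ permStatistic (equalWeights K) ω.1 ω.2.1 ω.2.2 b then (1 : ℝ) else 0)} ⊆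
      {ω | ENNReal.ofReal (α * z) ≤ (B : ℝ≥0∞)⁻¹ *
        ∑ b, (K : ℝ≥0∞)⁻¹ * ∑ k, G (ω.1 k, ω.2.1 k (ω.2.2 b k))} := by
    intro ω hω
    rw [Set.mem_ofPred_eq] at hω ⊢
    have hnn : ∀ b, 0 ≤ permStatistic (equalWeights K) ω.1 ω.2.1 ω.2.2 b := fun b =>
      itdSq_equalWeights_nonneg _ _
    -- Each round satisfies `z * 1{z ≤ T b} ≤ T b`, so more than a fraction `α` of large rounds
    -- forces the mean over the rounds to be at least `α * z`.
    have h1 : α * z ≤ (1 / (B : ℝ)) *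
        ∑ b, permStatistic (equalWeights K) ω.1 ω.2.1 ω.2.2 b := by
      refine (mul_le_mul_of_nonneg_right hω.le hz.le).trans ?_
      rw [mul_assoc, Finset.sum_mul]
      gcongr with b
      split_ifs with hb
      · rwa [one_mul]
      · rw [zero_mul]; exact hnn b
    refine (ENNReal.ofReal_le_ofReal h1).trans ?_
    rw [ENNReal.ofReal_mul (by positivity), one_div, ENNReal.ofReal_inv_of_pos hB0,
      ENNReal.ofReal_natCast, ENNReal.ofReal_sum_of_nonneg fun b _ => hnn b]
    gcongr with b
    exact hT ω b
  refine (measure_mono hsub).trans ((meas_ge_le_lintegral_div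
    (Measurable.aemeasurable (by fun_prop)) hαz ENNReal.ofReal_ne_top).trans ?_)
  rw [lintegral_const_mul _ (by fun_prop), lintegral_finsetSum _ (fun b _ => by fun_prop),
    ENNReal.div_eq_inv_mul, one_div]
  gcongr
  calc _ ≤ (B : ℝ≥0∞)⁻¹ * ∑ _b : Fin B, averageError R ε t m n P Q := by
        gcongr with b
        rw [lintegral_const_mul _ (by fun_prop), lintegral_finsetSum _ (fun k _ => hGω b k),
          averageError]
        gcongr with k
        exact hGi b k
    _ = ((B : ℝ≥0∞)⁻¹ * B) * averageError R ε t m n P Q := by simp [mul_assoc]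
    _ ≤ 1 * averageError R ε t m n P Q := by gcongr; exact ENNReal.inv_mul_le_one _
    _ = _ := one_mul _

/-- A lower bound on the power, uniform in the numbers of rounds and permutations. -/
theorem one_le_power_add (hC : IsCellPartition R ε t C) (hm : 1 ≤ m) (hn : 1 ≤ n) {α δ : ℝ}
    (hα : α ∈ Set.Ioo (0 : ℝ) 1) (hB : 1 ≤ B) (hδ : 0 < δ)
    (h : δ ≤ itdSq (equalWeights K) P Q) :
    1 ≤ power α (equalWeights K) m n B Bk P Q + errorFactor α δ * averageError R ε t m n P Q := by
  have hK : 0 < K := by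
    rcases Nat.eq_zero_or_pos K with rfl | hK
    · simp [itdSq] at h; linarith
    · exact hK
  set E₁ : Set (Data d m n K × Perms m n Bk × Selections B Bk) :=
    {ω | statistic (equalWeights K) ω.1 < δ / 8} with hE₁
  set E₂ : Set (Data d m n K × Perms m n Bk × Selections B Bk) := {ω | α < (1 / (B : ℝ)) *
      ∑ b, (if δ / 8 ≤ permStatistic (equalWeights K) ω.1 ω.2.1 ω.2.2 b then (1 : ℝ) else 0)}
    with hE₂
  -- Only monotonicity and subadditivity of the measure are used, so the rejection event and the
  -- failure events need not be measurable.
  have hcover : (Set.univ : Set (Data d m n K × Perms m n Bk × Selections B Bk)) ⊆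
      {ω | criticalValue α (permStatistic (equalWeights K) ω.1 ω.2.1 ω.2.2) ≤
        statistic (equalWeights K) ω.1} ∪ (E₁ ∪ E₂) := by
    intro ω _
    by_cases h₁ : ω ∈ E₁
    · exact Or.inr (Or.inl h₁)
    by_cases h₂ : ω ∈ E₂
    · exact Or.inr (Or.inr h₂)
    exact Or.inl ((criticalValue_le hα.2 (fun b => itdSq_equalWeights_nonneg _ _) (not_lt.1 h₂)
      hB).trans (not_lt.1 h₁))
  calc 1 = experimentLaw m n B Bk P Q Set.univ := measure_univ.symm
    _ ≤ power α (equalWeights K) m n B Bk P Q +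
        (experimentLaw m n B Bk P Q E₁ + experimentLaw m n B Bk P Q E₂) :=
      (measure_mono hcover).trans ((measure_union_le _ _).trans
        (add_le_add le_rfl (measure_union_le _ _)))
    _ ≤ _ := by
      rw [errorFactor, add_mul]
      gcongr
      · exact measure_statistic_lt_le hC hK hm hn hδ h
      · exact measure_permStatistic_ge_le hC hK hm hn hα.1 (by positivity) hB

end Events

end Power

/-! ### Choice of the parameters and uniform limits -/

section Limits

lemma tendsto_one_of_eventually_le {ι : Type*} {l : Filter ι} {f : ι → ℝ≥0∞} (h₁ : ∀ i, f i ≤ 1)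
    (h : ∀ η : ℝ≥0∞, η ≠ 0 → ∀ᶠ i in l, 1 ≤ f i + η) : Tendsto f l (𝓝 1) := by
  refine tendsto_order.2 ⟨fun a ha => ?_, fun a ha => Eventually.of_forall fun i =>
    (h₁ i).trans_lt ha⟩
  obtain ⟨b, hab, hb⟩ := exists_between ha
  filter_upwards [h (1 - b) (tsub_pos_of_lt hb).ne'] with i hi
  by_contra hle
  have hbne : b ≠ ∞ := ne_top_of_lt hb
  have : f i + (1 - b) < b + (1 - b) :=
    ENNReal.add_lt_add_right (ENNReal.sub_ne_top ENNReal.one_ne_top) ((not_lt.1 hle).trans_lt hab)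
  rw [add_tsub_cancel_of_le hb.le] at this
  exact absurd hi (not_le.2 this)

lemma tendsto_rate : Tendsto rate atTop (𝓝 0) := by
  have h : Tendsto (fun n : ℕ => 1 / √(n : ℝ)) atTop (𝓝 0) := by
    simp only [one_div]
    exact tendsto_inv_atTop_zero.comp
      (Real.tendsto_sqrt_atTop.comp tendsto_natCast_atTop_atTop)
  have h' := ENNReal.tendsto_ofReal h
  rw [ENNReal.ofReal_zero] at h'
  exact h'

variable {d : ℕ}

/-- The order of choice matters: `ε` is fixed first, which fixes the number of cells, and only then
do `m` and `n` grow. -/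
lemma exists_mainError_le (d : ℕ) (R : ℝ≥0) {θ : ℝ≥0∞} (hθ : θ ≠ 0) :
    ∃ (ε : ℝ≥0) (t : Finset ℕ) (C : ℕ → Set (Pt d)), IsCellPartition R ε t C ∧
      ∀ᶠ p : ℕ × ℕ in atTop ×ˢ atTop, mainError R ε t p.1 p.2 ≤ θ := by
  have hθ2 : 0 < θ / 2 := ENNReal.half_pos hθ
  have hcont : Tendsto (fun ε : ℝ≥0 => 2 * (ε : ℝ≥0∞) ^ 2) (𝓝 0) (𝓝 0) := by
    have hc : Continuous fun ε : ℝ≥0 => ((2 * ε ^ 2 : ℝ≥0) : ℝ≥0∞) := by fun_prop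
    have := hc.tendsto 0
    simpa using this
  obtain ⟨ε, hε, hε0⟩ := (((hcont.mono_left nhdsWithin_le_nhds).eventually
    (eventually_le_nhds hθ2)).and (self_mem_nhdsWithin (s := Set.Ioi (0 : ℝ≥0)))).exists
  obtain ⟨t, C, hC⟩ := exists_isCellPartition (d := d) R hε0
  refine ⟨ε, t, C, hC, ?_⟩
  have hr : Tendsto (fun p : ℕ × ℕ => 2 * (R : ℝ≥0∞) ^ 2 * (t.card * (rate p.1 + rate p.2)))
      (atTop ×ˢ atTop) (𝓝 0) := by
    have h0 : Tendsto (fun p : ℕ × ℕ => rate p.1 + rate p.2) (atTop ×ˢ atTop) (𝓝 (0 + 0)) :=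
      (tendsto_rate.comp tendsto_fst).add (tendsto_rate.comp tendsto_snd)
    have h1 := ENNReal.Tendsto.const_mul (a := (t.card : ℝ≥0∞)) h0 (Or.inr (by simp))
    have h2 := ENNReal.Tendsto.const_mul (a := 2 * (R : ℝ≥0∞) ^ 2) h1
      (Or.inr (ENNReal.mul_ne_top (by simp) (by simp)))
    simpa using h2
  filter_upwards [hr.eventually (eventually_le_nhds hθ2)] with p hp
  exact (add_le_add hε hp).trans_eq (ENNReal.add_halves θ)

/-- Outside the ball `R ≤ ‖x‖`, so two of the four powers of the norm pay for `R ^ 2`. -/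
lemma tailMoment_mul_sq_le (R : ℝ≥0) (μ : Measure (Pt d)) :
    tailMoment R μ * (R : ℝ≥0∞) ^ 2 ≤ fourthMoment μ := by
  rw [tailMoment, fourthMoment, ← lintegral_mul_const _ (by fun_prop)]
  refine (setLIntegral_mono (by fun_prop) fun x hx => ?_).trans (setLIntegral_le_lintegral _ _)
  have : (R : ℝ≥0∞) ≤ ‖x‖ₑ := by
    rw [Set.mem_compl_iff, mem_closedBall_zero_iff, not_le] at hx
    exact_mod_cast hx.le
  calc ‖x‖ₑ ^ 2 * (R : ℝ≥0∞) ^ 2 ≤ ‖x‖ₑ ^ 2 * ‖x‖ₑ ^ 2 := by gcongr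
    _ = ‖x‖ₑ ^ 4 := by ring

/-- The radius depends only on `M` and `θ`, not on `K` or the laws; no bound on any single client is
required. -/
lemma exists_average_tailMoment_le (d : ℕ) (M : ℝ) {θ : ℝ≥0∞} (hθ : θ ≠ 0) :
    ∃ R : ℝ≥0, ∀ (K : ℕ) (P Q : Fin K → Measure (Pt d)),
      ∑ k, (fourthMoment (P k) + fourthMoment (Q k)) ≤ (K : ℝ≥0∞) * ENNReal.ofReal M →
      (K : ℝ≥0∞)⁻¹ * ∑ k, (tailMoment R (P k) + tailMoment R (Q k)) ≤ θ := by
  set c : ℝ≥0∞ := ENNReal.ofReal M / θ with hc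
  have hcne : c ≠ ∞ := ENNReal.div_ne_top ENNReal.ofReal_ne_top hθ
  -- The added 1 gives `R ≤ R ^ 2`, so that `R ^ 2` dominates `c = M / θ`.
  have hR1 : 1 ≤ c.toNNReal + 1 := le_add_self
  have hR : c ≤ ((c.toNNReal + 1 : ℝ≥0) : ℝ≥0∞) ^ 2 := by
    calc c = (c.toNNReal : ℝ≥0∞) := (ENNReal.coe_toNNReal hcne).symm
      _ ≤ ((c.toNNReal + 1 : ℝ≥0) : ℝ≥0∞) := by exact_mod_cast le_self_add
      _ ≤ _ := le_self_pow (by exact_mod_cast hR1) two_ne_zero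
  refine ⟨c.toNNReal + 1, fun K P Q h => ?_⟩
  set R := c.toNNReal + 1
  have hR0 : (R : ℝ≥0∞) ^ 2 ≠ 0 := by
    have : (R : ℝ≥0∞) ≠ 0 := by exact_mod_cast (one_pos.trans_le hR1).ne'
    exact pow_ne_zero _ this
  have hRt : (R : ℝ≥0∞) ^ 2 ≠ ∞ := by simp
  have hM : ENNReal.ofReal M ≤ θ * (R : ℝ≥0∞) ^ 2 := by
    rw [mul_comm]
    exact (ENNReal.div_le_iff_le_mul (Or.inl hθ) (Or.inr hR0)).1 hR
  rw [← ENNReal.mul_le_mul_iff_left hR0 hRt]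
  refine le_trans ?_ hM
  rw [mul_assoc, Finset.sum_mul]
  calc _ ≤ (K : ℝ≥0∞)⁻¹ * ∑ k, (fourthMoment (P k) + fourthMoment (Q k)) := by
        gcongr with k
        rw [add_mul]
        exact add_le_add (tailMoment_mul_sq_le _ _) (tailMoment_mul_sq_le _ _)
    _ ≤ (K : ℝ≥0∞)⁻¹ * ((K : ℝ≥0∞) * ENNReal.ofReal M) := by gcongr
    _ ≤ 1 * ENNReal.ofReal M := by
        rw [← mul_assoc]; gcongr; exact ENNReal.inv_mul_le_one _
    _ = _ := one_mul _

lemma averageError_le {K : ℕ} (R ε : ℝ≥0) (t : Finset ℕ) (m n : ℕ)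
    (P Q : Fin K → Measure (Pt d)) :
    averageError R ε t m n P Q ≤ mainError R ε t m n +
      4 * ((K : ℝ≥0∞)⁻¹ * ∑ k, (tailMoment R (P k) + tailMoment R (Q k))) := by
  rw [averageError, Finset.sum_add_distrib, ← Finset.mul_sum, mul_add, mul_left_comm]
  gcongr
  simp only [Finset.sum_const, Finset.card_univ, Fintype.card_fin, nsmul_eq_mul]
  rw [← mul_assoc]
  exact mul_le_of_le_one_left zero_le (ENNReal.inv_mul_le_one _)

lemma exists_mul_le {A η : ℝ≥0∞} (hA : A ≠ ∞) (hη : η ≠ 0) : ∃ θ : ℝ≥0∞, θ ≠ 0 ∧ A * θ ≤ η :=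
  ⟨η / A, (ENNReal.div_pos hη hA).ne', ENNReal.mul_div_le⟩

/-- The power is eventually close to one, uniformly over the numbers of clients, rounds and
permutations, and over the client laws with bounded average fourth moment whose average squared
distance is bounded below. -/
theorem eventually_one_le_power_add (d : ℕ) {α : ℝ} (hα : α ∈ Set.Ioo (0 : ℝ) 1) {δ : ℝ}
    (hδ : 0 < δ) (M : ℝ) {η : ℝ≥0∞} (hη : η ≠ 0) :
    ∀ᶠ p : ℕ × ℕ in atTop ×ˢ atTop, ∀ (K B : ℕ) (Bk : Fin K → ℕ) (P Q : Fin K → Measure (Pt d)),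
      1 ≤ B → (∀ k, 1 ≤ Bk k) → (∀ k, IsProbabilityMeasure (P k)) →
      (∀ k, IsProbabilityMeasure (Q k)) →
      ∑ k, (fourthMoment (P k) + fourthMoment (Q k)) ≤ (K : ℝ≥0∞) * ENNReal.ofReal M →
      δ ≤ itdSq (equalWeights K) P Q →
      1 ≤ power α (equalWeights K) p.1 p.2 B Bk P Q + η := by
  obtain ⟨θ, hθ, hθη⟩ := exists_mul_le (errorFactor_ne_top hα.1 hδ) hη
  have hθ2 : θ / 2 ≠ 0 := (ENNReal.half_pos hθ).ne'
  obtain ⟨τ, hτ, hτθ⟩ := exists_mul_le (A := 4) (by simp) hθ2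
  obtain ⟨R, hR⟩ := exists_average_tailMoment_le d M hτ
  obtain ⟨ε, t, C, hC, hE⟩ := exists_mainError_le d R hθ2
  filter_upwards [hE, prod_mem_prod (eventually_ge_atTop 1) (eventually_ge_atTop 1)]
    with p hp hp1 K B Bk P Q hB hBk hP hQ hM hitd
  have : ∀ k, Nonempty (Fin (Bk k)) := fun k => ⟨⟨0, hBk k⟩⟩
  refine (one_le_power_add (Bk := Bk) hC hp1.1 hp1.2 hα hB hδ hitd).trans ?_
  gcongr
  refine le_trans ?_ hθη
  gcongr
  refine (averageError_le R ε t p.1 p.2 P Q).trans ?_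
  rw [← ENNReal.add_halves θ]
  exact add_le_add hp ((mul_le_mul' le_rfl (hR K P Q hM)).trans hτθ)

lemma power_le_one {K m n B : ℕ} {Bk : Fin K → ℕ} (hBk : ∀ k, 1 ≤ Bk k) (α : ℝ) (w : Fin K → ℝ)
    (P Q : Fin K → Measure (Pt d)) [∀ k, IsProbabilityMeasure (P k)]
    [∀ k, IsProbabilityMeasure (Q k)] : power α w m n B Bk P Q ≤ 1 := by
  have : ∀ k, Nonempty (Fin (Bk k)) := fun k => ⟨⟨0, hBk k⟩⟩
  exact prob_le_one (μ := experimentLaw m n B Bk P Q)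

lemma lintegral_sq_ne_top_of_fourthMoment {μ : Measure (Pt d)} [IsProbabilityMeasure μ]
    (h : fourthMoment μ < ∞) : ∫⁻ x, ‖x‖ₑ ^ 2 ∂μ ≠ ∞ := by
  refine ne_top_of_le_ne_top (b := 1 + fourthMoment μ)
    (ENNReal.add_ne_top.2 ⟨ENNReal.one_ne_top, h.ne⟩) ?_
  calc ∫⁻ x, ‖x‖ₑ ^ 2 ∂μ ≤ ∫⁻ x, (1 + ‖x‖ₑ ^ 4) ∂μ := by
        refine lintegral_mono fun x => ?_
        rcases le_total ‖x‖ₑ 1 with hx | hx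
        · exact (pow_le_one' hx 2).trans le_self_add
        · exact (pow_le_pow_right₀ hx (by norm_num)).trans le_add_self
    _ = 1 + fourthMoment μ := by
        rw [lintegral_add_left measurable_const, lintegral_const, measure_univ, mul_one,
          fourthMoment]

end Limits

/-! ### Clients drawn at random -/

section SampledClients

variable {d : ℕ} {X : Type*} [MeasurableSpace X]

lemma exists_tailMoment_le {ν : Measure (Pt d)} (hν : ∫⁻ x, ‖x‖ₑ ^ 2 ∂ν ≠ ∞) {θ : ℝ≥0∞}
    (hθ : θ ≠ 0) : ∃ R : ℝ≥0, tailMoment R ν ≤ θ := by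
  have hlim : Tendsto (fun n : ℕ => tailMoment (n : ℝ≥0) ν) atTop (𝓝 (∫⁻ _, 0 ∂ν)) := by
    simp only [tailMoment, ← lintegral_indicator measurableSet_closedBall.compl]
    refine tendsto_lintegral_of_dominated_convergence (fun x => ‖x‖ₑ ^ 2)
      (fun n => Measurable.indicator (by fun_prop) measurableSet_closedBall.compl)
      (fun n => ae_of_all _ fun x => Set.indicator_le_self _ _ x) hν (ae_of_all _ fun x => ?_)
    refine tendsto_const_nhds.congr' ?_
    filter_upwards [eventually_ge_atTop ⌈‖x‖⌉₊] with n hn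
    rw [Set.indicator_of_notMem]
    simpa using Nat.ceil_le.1 hn
  rw [lintegral_zero] at hlim
  obtain ⟨n, hn⟩ := (hlim.eventually (eventually_le_nhds (pos_iff_ne_zero.2 hθ))).exists
  exact ⟨n, hn⟩

lemma lintegral_sq_norm_le (μ : Measure (Pt d)) [IsProbabilityMeasure μ] (y₀ : Pt d) :
    ∫⁻ y, ‖y‖ₑ ^ 2 ∂μ ≤ 2 * ∫⁻ y, edist y y₀ ^ (2 : ℝ) ∂μ + 2 * ‖y₀‖ₑ ^ 2 := by
  calc ∫⁻ y, ‖y‖ₑ ^ 2 ∂μ ≤ ∫⁻ y, (2 * edist y y₀ ^ (2 : ℝ) + 2 * ‖y₀‖ₑ ^ 2) ∂μ := by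
        refine lintegral_mono fun y => ?_
        simpa using edist_sq_le y y₀ 0
    _ = _ := by
        rw [lintegral_add_right _ measurable_const, lintegral_const, measure_univ, mul_one,
          lintegral_const_mul _ (by fun_prop)]

lemma IsOfOrder.lintegral_sq_ne_top {μ : Measure (Pt d)} (h : IsOfOrder 2 μ) :
    ∫⁻ y, ‖y‖ₑ ^ 2 ∂μ ≠ ∞ := by
  obtain ⟨hp, y₀, hy₀⟩ := h
  simp only [edist_comm y₀] at hy₀
  exact ne_top_of_le_ne_top (ENNReal.add_ne_top.2 ⟨ENNReal.mul_ne_top (by simp) hy₀.ne,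
    ENNReal.mul_ne_top (by simp) (by simp)⟩) (lintegral_sq_norm_le μ y₀)

/-- The mixture of a kernel of order two has a finite second moment. -/
lemma lintegral_sq_bind_ne_top [MetricSpace X] {lam : Measure X} (hlam : IsOfOrder 2 lam)
    {P : Kernel X (Pt d)} (hP : IsKernelOfOrder 2 P) :
    ∫⁻ y, ‖y‖ₑ ^ 2 ∂(lam.bind P) ≠ ∞ := by
  obtain ⟨hlp, x₁, hx₁⟩ := hlam
  obtain ⟨hPx, x₀, y₀, c, hc, hbound⟩ := hP
  rw [Measure.lintegral_bind P.measurable.aemeasurable (by fun_prop)]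
  have hx₀ : ∫⁻ x, edist x x₀ ^ (2 : ℝ) ∂lam ≠ ∞ := by
    refine ne_top_of_le_ne_top (b := 2 * ∫⁻ x, edist x₁ x ^ (2 : ℝ) ∂lam + 2 * edist x₁ x₀ ^ 2)
      (ENNReal.add_ne_top.2 ⟨ENNReal.mul_ne_top (by simp) hx₁.ne,
        ENNReal.mul_ne_top (by simp) (ENNReal.pow_ne_top (edist_ne_top _ _))⟩) ?_
    calc _ ≤ ∫⁻ x, (2 * edist x₁ x ^ (2 : ℝ) + 2 * edist x₁ x₀ ^ 2) ∂lam := by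
          refine lintegral_mono fun x => ?_
          have := edist_sq_le x x₁ x₀
          rw [edist_comm x x₁] at this
          simpa using this
      _ = _ := by
          rw [lintegral_add_right _ measurable_const, lintegral_const, measure_univ, mul_one,
            lintegral_const_mul' _ _ (by simp)]
  refine ne_top_of_le_ne_top (b := 2 * (ENNReal.ofReal c * (1 + ∫⁻ x, edist x x₀ ^ (2 : ℝ) ∂lam)) +
    2 * ‖y₀‖ₑ ^ 2) ?_ ?_
  · exact ENNReal.add_ne_top.2 ⟨ENNReal.mul_ne_top (by simp) (ENNReal.mul_ne_top (by simp)
      (ENNReal.add_ne_top.2 ⟨by simp, hx₀⟩)), ENNReal.mul_ne_top (by simp) (by simp)⟩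
  · calc _ ≤ ∫⁻ x, (2 * (ENNReal.ofReal c * (1 + edist x x₀ ^ (2 : ℝ))) + 2 * ‖y₀‖ₑ ^ 2) ∂lam := by
          refine lintegral_mono fun x => ?_
          have := (hPx x).1
          refine (lintegral_sq_norm_le (P x) y₀).trans ?_
          gcongr
          exact hbound x
      _ = _ := by
          rw [lintegral_add_right _ measurable_const, lintegral_const, measure_univ, mul_one,
            lintegral_const_mul' _ _ (by simp), lintegral_const_mul' _ _ (by simp),
            lintegral_add_left measurable_const, lintegral_const, measure_univ, mul_one]

lemma measurable_tailMoment_kernel (R : ℝ≥0) (P : Kernel X (Pt d)) :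
    Measurable fun x => tailMoment R (P x) := by
  simp only [tailMoment, ← lintegral_indicator measurableSet_closedBall.compl]
  exact (Measure.measurable_lintegral
    (Measurable.indicator (by fun_prop) measurableSet_closedBall.compl)).comp P.measurable

/-- Averaging over the clients turns tails of the kernel into the tail of one mixture, so that a
single radius works in expectation without uniformity in `x`. -/
lemma lintegral_tailMoment_kernel (R : ℝ≥0) (lam : Measure X) (P : Kernel X (Pt d)) :
    ∫⁻ x, tailMoment R (P x) ∂lam = tailMoment R (lam.bind P) := by
  have hm : Measurable ((Metric.closedBall (0 : Pt d) (R : ℝ))ᶜ.indicator fun x => ‖x‖ₑ ^ 2) :=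
    Measurable.indicator (by fun_prop) measurableSet_closedBall.compl
  simp only [tailMoment, ← lintegral_indicator measurableSet_closedBall.compl]
  rw [Measure.lintegral_bind P.measurable.aemeasurable hm.aemeasurable]

/-- Kernels at a positive distance have a positive transport cost, bounded below, on a set of
positive measure. -/
lemma exists_le_transportCost_of_kernelITD_pos {lam : Measure X} {P Q : Kernel X (Pt d)}
    (h : 0 < kernelITD 2 lam P Q) :
    ∃ (S : Set X) (c : ℝ), MeasurableSet S ∧ lam S ≠ 0 ∧ 0 < c ∧
      ∀ x ∈ S, ENNReal.ofReal c ≤ transportCost (P x) (Q x) := by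
  simp only [kernelITD, wasserstein_two_rpow_two] at h
  have hne : ∫⁻ x, transportCost (P x) (Q x) ∂lam ≠ 0 := by
    intro h0
    rw [h0, ENNReal.zero_rpow_of_pos (by norm_num)] at h
    exact lt_irrefl _ h
  -- A measurable minorant with the same integral replaces the transport cost, so that its level
  -- sets are measurable.
  obtain ⟨g, hg, hgle, hgeq⟩ := exists_measurable_le_lintegral_eq lam
    (fun x => transportCost (P x) (Q x))
  rw [hgeq] at hne
  by_contra! hcon
  refine hne ((lintegral_eq_zero_iff hg).2 ?_)
  have hnull : ∀ n : ℕ, ∀ᵐ x ∂lam, ¬ ENNReal.ofReal (1 / (n + 1)) ≤ g x := by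
    intro n
    rw [ae_iff]
    by_contra hpos
    obtain ⟨x, hx, hlt⟩ := hcon {x | ENNReal.ofReal (1 / (n + 1)) ≤ g x} (1 / (n + 1))
      (measurableSet_le measurable_const hg) (by simpa using hpos) (by positivity)
    exact absurd (hx.trans (hgle x)) (not_le.2 hlt)
  filter_upwards [ae_all_iff.2 hnull] with x hx
  by_contra hx0
  obtain ⟨r, hr0, hr⟩ := ENNReal.lt_iff_exists_real_btwn.1 (pos_iff_ne_zero.2 hx0)
  obtain ⟨n, hn⟩ := exists_nat_one_div_lt (K := ℝ) (ENNReal.ofReal_pos.1 hr.1)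
  exact hx n ((ENNReal.ofReal_le_ofReal hn.le).trans hr.2.le)

/-- A weak law of large numbers for frequencies. -/
lemma measure_frequency_lt_le (lam : Measure X) [IsProbabilityMeasure lam] {S : Set X}
    (hS : MeasurableSet S) (hS0 : lam S ≠ 0) {K : ℕ} (hK : 1 ≤ K) :
    (Measure.pi fun _ : Fin K => lam)
      {x | 1 / (K : ℝ) * ∑ k, S.indicator 1 (x k) < (lam S).toReal / 2} ≤
      ENNReal.ofReal (1 / K) / ENNReal.ofReal (((lam S).toReal / 2) ^ 2) := by
  have hp : 0 < (lam S).toReal := ENNReal.toReal_pos hS0 (measure_ne_top _ _)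
  have hind : Measurable (S.indicator (1 : X → ℝ)) := measurable_one.indicator hS
  have hdev := lintegral_sq_average_pi_le lam hind (indicator_one_mem_Icc S) hK
  rw [integral_indicator_one hS] at hdev
  refine (measure_mono fun x hx => ?_).trans ((meas_ge_le_lintegral_div
    (f := fun x : Fin K → X => ENNReal.ofReal
      ((1 / (K : ℝ) * ∑ k, S.indicator 1 (x k) - lam.real S) ^ 2))
    (Measurable.aemeasurable (by fun_prop)) (ε := ENNReal.ofReal (((lam S).toReal / 2) ^ 2))
    ?_ ENNReal.ofReal_ne_top).trans (ENNReal.div_le_div_right hdev _))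
  · rw [Set.mem_ofPred_eq] at hx ⊢
    refine ENNReal.ofReal_le_ofReal ?_
    rw [measureReal_def]
    nlinarith
  · simpa using hp.ne'

/-- Consistency for sampled clients. -/
theorem tendsto_lintegral_power [MetricSpace X] {α : ℝ} (hα : α ∈ Set.Ioo (0 : ℝ) 1)
    {B : ℕ → ℕ → ℕ → ℕ} (hB : ∀ m n K, 1 ≤ B m n K)
    {Bk : ℕ → ℕ → (K : ℕ) → Fin K → ℕ} (hBk : ∀ m n K k, 1 ≤ Bk m n K k)
    {lam : Measure X} {P Q : Kernel X (Pt d)} (hlam : IsOfOrder 2 lam)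
    (hP : IsKernelOfOrder 2 P) (hQ : IsKernelOfOrder 2 Q) (h : 0 < kernelITD 2 lam P Q) :
    Tendsto (fun t : ℕ × ℕ × ℕ =>
        ∫⁻ x : Fin t.2.2 → X,
          power α (equalWeights t.2.2) t.1 t.2.1 (B t.1 t.2.1 t.2.2) (Bk t.1 t.2.1 t.2.2)
            (fun k => P (x k)) (fun k => Q (x k))
          ∂(Measure.pi fun _ : Fin t.2.2 => lam))
      (atTop ×ˢ atTop ×ˢ atTop) (𝓝 1) := by
  have := hlam.1
  have hPp : ∀ x, IsProbabilityMeasure (P x) := fun x => (hP.1 x).1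
  have hQp : ∀ x, IsProbabilityMeasure (Q x) := fun x => (hQ.1 x).1
  obtain ⟨S, c, hS, hS0, hc, hSc⟩ := exists_le_transportCost_of_kernelITD_pos h
  have hp : 0 < (lam S).toReal := ENNReal.toReal_pos hS0 (measure_ne_top _ _)
  set p := (lam S).toReal
  -- With high probability at least a fraction `p / 2` of the clients, half the expected one, lies
  -- in `S`, and each of them contributes at least `c`.
  have hδ : 0 < c * (p / 2) := by positivity
  refine tendsto_one_of_eventually_le (fun t => ?_) fun η hη => ?_
  · refine (lintegral_mono fun x => power_le_one (hBk _ _ _) α _ _ _).trans ?_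
    simp
  have hη2 : η / 2 ≠ 0 := (ENNReal.half_pos hη).ne'
  obtain ⟨θ, hθ, hθη⟩ := exists_mul_le (errorFactor_ne_top hα.1 hδ) hη2
  have hθ2 : θ / 2 ≠ 0 := (ENNReal.half_pos hθ).ne'
  obtain ⟨τ, hτ, hτθ⟩ := exists_mul_le (A := 4) (by simp) hθ2
  -- The sum of the two mixtures yields one radius for both kernels.
  obtain ⟨R, hR⟩ := exists_tailMoment_le (ν := lam.bind P + lam.bind Q) (by
    rw [lintegral_add_measure]
    exact ENNReal.add_ne_top.2 ⟨lintegral_sq_bind_ne_top hlam hP,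
      lintegral_sq_bind_ne_top hlam hQ⟩) hτ
  obtain ⟨ε, t, C, hC, hE⟩ := exists_mainError_le d R hθ2
  have hfreq : ∀ᶠ K : ℕ in atTop,
      ENNReal.ofReal (1 / K) / ENNReal.ofReal ((p / 2) ^ 2) ≤ η / 2 := by
    have h0 : Tendsto (fun K : ℕ => ENNReal.ofReal (1 / (K : ℝ))) atTop (𝓝 0) := by
      simpa using ENNReal.tendsto_ofReal tendsto_one_div_atTop_nhds_zero_nat
    have hpne : ENNReal.ofReal ((p / 2) ^ 2) ≠ 0 := by
      simpa using hp.ne'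
    have h1 := ENNReal.Tendsto.div_const h0 (b := ENNReal.ofReal ((p / 2) ^ 2)) (Or.inr hpne)
    rw [ENNReal.zero_div] at h1
    exact h1.eventually (eventually_le_nhds (pos_iff_ne_zero.2 hη2))
  have hproj : Tendsto (fun t : ℕ × ℕ × ℕ => (t.1, t.2.1)) (atTop ×ˢ atTop ×ˢ atTop)
      (atTop ×ˢ atTop) := tendsto_fst.prodMk (tendsto_fst.comp tendsto_snd)
  have hprojK : Tendsto (fun t : ℕ × ℕ × ℕ => t.2.2) (atTop ×ˢ atTop ×ˢ atTop) atTop :=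
    tendsto_snd.comp tendsto_snd
  filter_upwards [hproj.eventually hE, hproj.eventually (prod_mem_prod (eventually_ge_atTop 1)
    (eventually_ge_atTop 1)), hprojK.eventually hfreq, hprojK.eventually (eventually_ge_atTop 1)]
    with ⟨m, n, K⟩ hmn hmn1 hKf hK1
  simp only at hmn hKf hK1 ⊢
  have hind : Measurable (S.indicator (1 : X → ℝ)) := measurable_one.indicator hS
  set E : Set (Fin K → X) := {x | 1 / (K : ℝ) * ∑ k, S.indicator 1 (x k) < p / 2} with hEdef
  have hEm : MeasurableSet E := measurableSet_lt (by fun_prop) measurable_const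
  -- On the exceptional set `E` the indicator alone gives 1; elsewhere the draw of clients is
  -- treated as fixed, with the separation `c * (p / 2)`.
  have hpow : ∀ x : Fin K → X, 1 ≤ power α (equalWeights K) m n (B m n K) (Bk m n K)
      (fun k => P (x k)) (fun k => Q (x k)) + (E.indicator 1 x + errorFactor α (c * (p / 2)) *
        averageError R ε t m n (fun k => P (x k)) (fun k => Q (x k))) := by
    intro x
    by_cases hx : x ∈ E
    · rw [Set.indicator_of_mem hx]
      exact le_add_left le_self_add
    · rw [Set.indicator_of_notMem hx, zero_add]
      have : ∀ k, Nonempty (Fin (Bk m n K k)) := fun k => ⟨⟨0, hBk m n K k⟩⟩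
      refine one_le_power_add hC hmn1.1 hmn1.2 hα (hB m n K) hδ ?_
      rw [itdSq_equalWeights]
      calc c * (p / 2) ≤ c * (1 / (K : ℝ) * ∑ k, S.indicator 1 (x k)) := by
            gcongr; exact not_lt.1 hx
        _ = 1 / (K : ℝ) * ∑ k, c * S.indicator 1 (x k) := by rw [← Finset.mul_sum]; ring
        _ ≤ _ := by
            gcongr with k
            by_cases hk : x k ∈ S
            · rw [Set.indicator_of_mem hk, Pi.one_apply, mul_one]
              exact (ENNReal.ofReal_le_iff_le_toReal (transportCost_ne_top _ _
                (hP.1 _).lintegral_sq_ne_top (hQ.1 _).lintegral_sq_ne_top)).1 (hSc _ hk)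
            · rw [Set.indicator_of_notMem hk, mul_zero]
              exact ENNReal.toReal_nonneg
  have hPm := measurable_tailMoment_kernel R P
  have hQm := measurable_tailMoment_kernel R Q
  have hPk : ∀ k, Measurable fun x : Fin K → X => tailMoment R (P (x k)) :=
    fun k => hPm.comp (measurable_pi_apply k)
  have hQk : ∀ k, Measurable fun x : Fin K → X => tailMoment R (Q (x k)) :=
    fun k => hQm.comp (measurable_pi_apply k)
  have hEind : Measurable (E.indicator (1 : (Fin K → X) → ℝ≥0∞)) := measurable_one.indicator hEm
  have hav : ∫⁻ x : Fin K → X, averageError R ε t m n (fun k => P (x k)) (fun k => Q (x k))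
      ∂(Measure.pi fun _ => lam) ≤ θ := by
    refine (lintegral_mono fun x => averageError_le R ε t m n _ _).trans ?_
    rw [lintegral_add_left measurable_const, lintegral_const, measure_univ, mul_one,
      lintegral_const_mul _ (by fun_prop), lintegral_const_mul _ (by fun_prop),
      lintegral_finsetSum _ (fun k _ => by fun_prop)]
    have hk : ∀ k : Fin K, ∫⁻ x : Fin K → X, (tailMoment R (P (x k)) + tailMoment R (Q (x k)))
        ∂(Measure.pi fun _ => lam) ≤ τ := by
      intro k
      have e := (measurePreserving_eval (fun _ : Fin K => lam) k).lintegral_comp (hPm.add hQm)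
      refine e.trans_le ?_
      simp only [Pi.add_apply]
      rw [lintegral_add_left hPm, lintegral_tailMoment_kernel, lintegral_tailMoment_kernel]
      rwa [tailMoment, Measure.restrict_add, lintegral_add_measure] at hR
    rw [← ENNReal.add_halves θ]
    refine add_le_add hmn (le_trans (mul_le_mul' le_rfl ?_) hτθ)
    calc _ ≤ (K : ℝ≥0∞)⁻¹ * ∑ _k : Fin K, τ := by gcongr with k; exact hk k
      _ = ((K : ℝ≥0∞)⁻¹ * K) * τ := by simp [mul_assoc]
      _ ≤ 1 * τ := by gcongr; exact ENNReal.inv_mul_le_one _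
      _ = τ := one_mul _
  have havm : Measurable fun x : Fin K → X =>
      averageError R ε t m n (fun k => P (x k)) (fun k => Q (x k)) := by
    simp only [averageError]; fun_prop
  have h1 : 1 ≤ ∫⁻ x : Fin K → X, (power α (equalWeights K) m n (B m n K) (Bk m n K)
      (fun k => P (x k)) (fun k => Q (x k)) + (E.indicator 1 x + errorFactor α (c * (p / 2)) *
        averageError R ε t m n (fun k => P (x k)) (fun k => Q (x k))))
      ∂(Measure.pi fun _ => lam) := by
    calc (1 : ℝ≥0∞) = ∫⁻ _ : Fin K → X, 1 ∂(Measure.pi fun _ => lam) := by simp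
      _ ≤ _ := lintegral_mono hpow
  refine h1.trans ?_
  -- The integral splits because the error terms are measurable; the power need not be.
  rw [lintegral_add_right _ (by fun_prop), lintegral_add_left hEind, lintegral_indicator_one hEm,
    lintegral_const_mul _ havm]
  gcongr
  rw [← ENNReal.add_halves η]
  exact add_le_add ((measure_frequency_lt_le lam hS hS0 hK1).trans hKf)
    ((mul_le_mul' le_rfl hav).trans hθη)

end SampledClients

end DistributedTest

/-! ### The three consistency statements -/

open DistributedTest in
theorem mainTheorem4 (d : ℕ) (α : ℝ) (hα : α ∈ Set.Ioo (0 : ℝ) 1)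
    -- numbers of rounds of the server and of permutations of the clients, given `m`, `n`, `K`
    (B : ℕ → ℕ → ℕ → ℕ) (hB : ∀ m n K, 1 ≤ B m n K)
    (Bk : ℕ → ℕ → (K : ℕ) → Fin K → ℕ) (hBk : ∀ m n K k, 1 ≤ Bk m n K k) :
    -- the number of clients is fixed
    (∀ (K : ℕ) (P Q : Fin K → Measure (Pt d)),
      (∀ k, IsProbabilityMeasure (P k) ∧ HasDensity (P k) ∧ fourthMoment (P k) < ∞) →
      (∀ k, IsProbabilityMeasure (Q k) ∧ HasDensity (Q k) ∧ fourthMoment (Q k) < ∞) →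
      (∃ k, P k ≠ Q k) →
      Tendsto (fun t : ℕ × ℕ =>
          power α (equalWeights K) t.1 t.2 (B t.1 t.2 K) (Bk t.1 t.2 K) P Q)
        (atTop ×ˢ atTop) (𝓝 1)) ∧
    -- the number of clients grows, the clients having given distributions
    (∀ P Q : ℕ → Measure (Pt d),
      (∀ k, IsProbabilityMeasure (P k) ∧ HasDensity (P k) ∧ fourthMoment (P k) < ∞) →
      (∀ k, IsProbabilityMeasure (Q k) ∧ HasDensity (Q k) ∧ fourthMoment (Q k) < ∞) →
      (∃ M : ℝ, ∀ K : ℕ, ∑ k : Fin K, (fourthMoment (P k) + fourthMoment (Q k)) ≤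
        (K : ℝ≥0∞) * ENNReal.ofReal M) →
      (∃ δ : ℝ, 0 < δ ∧ ∀ᶠ K : ℕ in atTop,
        δ ≤ itdSq (equalWeights K) (fun k => P k) (fun k => Q k)) →
      Tendsto (fun t : ℕ × ℕ × ℕ =>
          power α (equalWeights t.2.2) t.1 t.2.1 (B t.1 t.2.1 t.2.2) (Bk t.1 t.2.1 t.2.2)
            (fun k => P k) (fun k => Q k))
        (atTop ×ˢ atTop ×ˢ atTop) (𝓝 1)) ∧
    -- the number of clients grows, the clients being drawn independently from a law `lam`
    (∀ (X : Type*) [MetricSpace X] [CompleteSpace X] [SecondCountableTopology X]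
      [MeasurableSpace X] [BorelSpace X] (lam : Measure X) (P Q : Kernel X (Pt d)),
      IsOfOrder 2 lam → IsKernelOfOrder 2 P → IsKernelOfOrder 2 Q →
      (∀ᵐ x ∂lam, HasDensity (P x) ∧ fourthMoment (P x) < ∞) →
      (∀ᵐ x ∂lam, HasDensity (Q x) ∧ fourthMoment (Q x) < ∞) →
      0 < kernelITD 2 lam P Q →
      Tendsto (fun t : ℕ × ℕ × ℕ =>
          ∫⁻ x : Fin t.2.2 → X,
            power α (equalWeights t.2.2) t.1 t.2.1 (B t.1 t.2.1 t.2.2) (Bk t.1 t.2.1 t.2.2)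
              (fun k => P (x k)) (fun k => Q (x k))
            ∂(Measure.pi fun _ : Fin t.2.2 => lam))
        (atTop ×ˢ atTop ×ˢ atTop) (𝓝 1)) := by
  refine ⟨fun K P Q hP hQ hne => ?_, fun P Q hP hQ hM hδ => ?_,
    fun X _ _ _ _ _ lam P Q hlam hP hQ _ _ h => tendsto_lintegral_power hα hB hBk hlam hP hQ h⟩
  · have hPp := fun k => (hP k).1
    have hQp := fun k => (hQ k).1
    have hfin : ∀ k, transportCost (P k) (Q k) ≠ ∞ := fun k => transportCost_ne_top _ _
      (lintegral_sq_ne_top_of_fourthMoment (hP k).2.2)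
      (lintegral_sq_ne_top_of_fourthMoment (hQ k).2.2)
    obtain ⟨k₀, hk₀⟩ := hne
    have hK : 0 < K := k₀.pos
    have hK1 : (1 : ℝ≥0∞) ≤ K := by exact_mod_cast hK
    -- For a fixed family of clients `δ` is the squared distance itself, positive because zero
    -- transport cost would force `P k₀ = Q k₀`.
    have hpos : 0 < itdSq (equalWeights K) P Q := by
      rw [itdSq_equalWeights]
      have hK0 : (0 : ℝ) < K := by exact_mod_cast hK
      refine mul_pos (by positivity) (Finset.sum_pos' (fun _ _ => ENNReal.toReal_nonneg)
        ⟨k₀, Finset.mem_univ _, ENNReal.toReal_pos (fun h0 => hk₀ ?_) (hfin k₀)⟩)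
      exact eq_of_transportCost_eq_zero _ _ h0
    have hS : ∑ k, (fourthMoment (P k) + fourthMoment (Q k)) ≠ ∞ :=
      ENNReal.sum_ne_top.2 fun k _ => ENNReal.add_ne_top.2 ⟨(hP k).2.2.ne, (hQ k).2.2.ne⟩
    refine tendsto_one_of_eventually_le (fun t => power_le_one (hBk _ _ _) _ _ _ _) fun η hη => ?_
    -- The total of the fourth moments serves as `M`, since `1 ≤ K`.
    filter_upwards [eventually_one_le_power_add d hα hpos
      (∑ k, (fourthMoment (P k) + fourthMoment (Q k))).toReal hη] with p hp
    refine hp K _ _ P Q (hB _ _ _) (hBk _ _ _) hPp hQp ?_ le_rfl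
    rw [ENNReal.ofReal_toReal hS]
    exact le_mul_of_one_le_left zero_le hK1
  · have hPp := fun k => (hP k).1
    have hQp := fun k => (hQ k).1
    obtain ⟨M, hM⟩ := hM
    obtain ⟨δ, hδ, hev⟩ := hδ
    refine tendsto_one_of_eventually_le (fun t => power_le_one (hBk _ _ _) _ _ _ _) fun η hη => ?_
    have hproj : Tendsto (fun t : ℕ × ℕ × ℕ => (t.1, t.2.1)) (atTop ×ˢ atTop ×ˢ atTop)
        (atTop ×ˢ atTop) := tendsto_fst.prodMk (tendsto_fst.comp tendsto_snd)
    have hprojK : Tendsto (fun t : ℕ × ℕ × ℕ => t.2.2) (atTop ×ˢ atTop ×ˢ atTop) atTop :=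
      tendsto_snd.comp tendsto_snd
    -- The threshold for `m` and `n` does not depend on `K`, which makes the limit joint.
    filter_upwards [hproj.eventually (eventually_one_le_power_add d hα hδ M hη),
      hprojK.eventually hev] with t ht htK
    exact ht t.2.2 _ _ (fun k => P k) (fun k => Q k) (hB _ _ _) (hBk _ _ _) (fun k => hPp k)
      (fun k => hQp k) (hM _) htK
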